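/- Let $q$ be a complex number with $|q|<1$. Put $(a;q)_\infty=\prod_{n\ge 0}(1-aq^n)$, $E(q)=(q;q)_\infty$, $\varphi(q)=\sum_{n=-\infty}^{\infty}q^{n^2}$, and let $\left(\frac{a}{n}\right)$ denote the Kronecker symbol (so that $\left(\frac{-15}{2}\right)=1$ and $\left(\frac{5}{2}\right)=-1$). Define $$P(q)=\frac{E(q)E(q^6)E(q^{10})E(q^{15})}{E(q^2)E(q^{30})},\qquad Q(q)=q\,\frac{E(q^2)E(q^3)E(q^5)E(q^{30})}{E(q^6)E(q^{10})}.$$ Then the series below converge absolutely and $$P(q)=1-\sum_{n=1}^{\infty}\left(\frac{-15}{n}\right)\frac{q^n}{1+q^n},\qquad Q(q)=\sum_{n=1}^{\infty}\left(\frac{5}{n}\right)\frac{q^n(1+q^n)}{1+q^{3n}}.$$ Moreover, $$\varphi(-q)\varphi(-q^{15})=P(q)-Q(q)=1-\sum_{n=1}^{\infty}\left(\frac{-15}{n}\right)\frac{q^n}{1+q^n}-\sum_{n=1}^{\infty}\left(\frac{5}{n}\right)\frac{q^n(1+q^n)}{1+q^{3n}}$$ and $$\varphi(-q^3)\varphi(-q^5)=P(q)+Q(q)=1-\sum_{n=1}^{\infty}\left(\frac{-15}{n}\right)\frac{q^n}{1+q^n}+\sum_{n=1}^{\infty}\left(\frac{5}{n}\right)\frac{q^n(1+q^n)}{1+q^{3n}}.$$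 -/

import Mathlib

namespace RamanujanLambert

noncomputable section

/-- The infinite `q`-shifted factorial `(a; q)_∞ = ∏_{n ≥ 0} (1 - a q ^ n)`. -/
def qPochhammerInf (a q : ℂ) : ℂ := ∏' n : ℕ, (1 - a * q ^ n)

/-- `E(q) = (q; q)_∞`. -/
def E (q : ℂ) : ℂ := qPochhammerInf q q

/-- Ramanujan's general theta function
`f(a, b) = ∑_{n ∈ ℤ} a ^ (n (n + 1) / 2) * b ^ (n (n - 1) / 2)`.
The divisions by two are exact and both exponents are nonnegative integers. -/
def ramanujanF (a b : ℂ) : ℂ :=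
  ∑' n : ℤ, a ^ (n * (n + 1) / 2) * b ^ (n * (n - 1) / 2)

/-- Ramanujan's theta function `φ(q) = f(q, q) = ∑_{n ∈ ℤ} q ^ (n ^ 2)`. -/
def phi (q : ℂ) : ℂ := ramanujanF q q

/-- The Kronecker symbol `(a / n)` for an integer `a` and a natural number `n`.
For `n = 2 ^ k * m` with `m` odd it is `(a / 2) ^ k` times the Jacobi symbol `(a / m)`. Here
`(a / 2)` is `0` for even `a`, `1` for `a ≡ ±1` and `-1` for `a ≡ ±3` modulo `8`,
which is the value at `a` of the character `ZMod.χ₈`. -/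
def kroneckerSym (a : ℤ) (n : ℕ) : ℤ :=
  if n = 0 then (if a.natAbs = 1 then 1 else 0)
  else ZMod.χ₈ (a : ZMod 8) ^ padicValNat 2 n * jacobiSym a (n / 2 ^ padicValNat 2 n)

/-- The eta-quotient `P(q)`. -/
def P (q : ℂ) : ℂ :=
  E q * E (q ^ 6) * E (q ^ 10) * E (q ^ 15) / (E (q ^ 2) * E (q ^ 30))

/-- The eta-quotient `Q(q)`. -/
def Q (q : ℂ) : ℂ :=
  q * (E (q ^ 2) * E (q ^ 3) * E (q ^ 5) * E (q ^ 30) / (E (q ^ 6) * E (q ^ 10)))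

/-- The general term `(-15 / n) q ^ n / (1 + q ^ n)` of the Lambert series for `P`. -/
def termP (q : ℂ) (n : ℕ) : ℂ :=
  (kroneckerSym (-15) n : ℂ) * (q ^ n / (1 + q ^ n))

/-- The general term `(5 / n) q ^ n (1 + q ^ n) / (1 + q ^ (3 n))` of the Lambert series
for `Q`. -/
def termQ (q : ℂ) (n : ℕ) : ℂ :=
  (kroneckerSym 5 n : ℂ) * (q ^ n * (1 + q ^ n) / (1 + q ^ (3 * n)))

/-- Well-definedness: the product defining `(a; q)_∞` converges for `|q| < 1`. -/
theorem multipliable_qPochhammerInf (a q : ℂ) (hq : ‖q‖ < 1) :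
    Multipliable fun n : ℕ => 1 - a * q ^ n := by
  have hs : Summable fun n : ℕ => ‖-(a * q ^ n)‖ := by
    simp only [norm_neg, norm_mul, norm_pow]
    exact (summable_geometric_of_lt_one (norm_nonneg q) hq).mul_left _
  simpa [sub_eq_add_neg] using multipliable_one_add_of_summable hs

/-- Well-definedness: `E` has no zero in the unit disc, so the denominators of `P` and `Q` do
not vanish. -/
theorem E_ne_zero (q : ℂ) (hq : ‖q‖ < 1) : E q ≠ 0 := by
  have hs : Summable fun n : ℕ => ‖-(q * q ^ n)‖ := by
    simp only [norm_neg, norm_mul, norm_pow]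
    exact (summable_geometric_of_lt_one (norm_nonneg q) hq).mul_left _
  have h1 : ∀ n : ℕ, 1 + -(q * q ^ n) ≠ 0 := by
    intro n h
    have h2 : q ^ (n + 1) = 1 := by rw [pow_succ']; linear_combination -h
    have h3 : ‖q‖ ^ (n + 1) < 1 := pow_lt_one₀ (norm_nonneg q) hq (Nat.succ_ne_zero n)
    rw [← norm_pow, h2, norm_one] at h3
    exact lt_irrefl _ h3
  have := tprod_one_add_ne_zero_of_summable h1 hs
  simpa [E, qPochhammerInf, sub_eq_add_neg] using this

/-- The term of the series for `φ(q)` is `q ^ (n ^ 2)`. -/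
theorem phi_term (q : ℂ) (n : ℤ) :
    q ^ (n * (n + 1) / 2) * q ^ (n * (n - 1) / 2) = q ^ (n.natAbs ^ 2) := by
  obtain ⟨k, hk⟩ := Int.even_mul_succ_self n
  have e1 : n * (n + 1) / 2 = k := by omega
  have e2 : n * (n - 1) / 2 = k - n := by
    have : n * (n - 1) = 2 * (k - n) := by linear_combination hk
    omega
  have hk0 : 0 ≤ k := by
    rcases le_or_gt 0 n with h | h <;> nlinarith
  have hkn : 0 ≤ k - n := by
    rcases le_or_gt 1 n with h | h <;> nlinarith
  rw [e1, e2]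
  lift k to ℕ using hk0
  obtain ⟨m, hm⟩ := Int.eq_ofNat_of_zero_le hkn
  rw [hm, zpow_natCast, zpow_natCast, ← pow_add]
  congr 1
  zify
  rw [sq_abs, ← hm]
  linear_combination -hk

/-- Well-definedness: `φ(q) = ∑_{n ∈ ℤ} q ^ (n ^ 2)`, and the series converges absolutely for
`|q| < 1`. -/
theorem hasSum_phi (q : ℂ) (hq : ‖q‖ < 1) :
    HasSum (fun n : ℤ => q ^ (n.natAbs ^ 2)) (phi q) := by
  have hN : Summable fun n : ℕ => q ^ (n ^ 2) := by
    refine Summable.of_norm_bounded (summable_geometric_of_lt_one (norm_nonneg q) hq) ?_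
    intro n
    rw [norm_pow]
    exact pow_le_pow_of_le_one (norm_nonneg q) hq.le (Nat.le_self_pow two_ne_zero n)
  have hZ : Summable fun n : ℤ => q ^ (n.natAbs ^ 2) :=
    Summable.of_nat_of_neg (by simpa using hN) (by simpa using hN)
  have he : phi q = ∑' n : ℤ, q ^ (n.natAbs ^ 2) := by
    simp only [phi, ramanujanF, phi_term]
  rw [he]
  exact hZ.hasSum

end

end RamanujanLambert

open RamanujanLambert

/-! Everything rests on the Jacobi triple product (`thetaJ_eq`) for θ(z) = ∑ (-1)^n Q^(n(n-1)/2)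
z^n; the Lambert series and the theta products are then treated independently.

Lambert series. Sorting the double series of θ(xy)θ(x/y) by parity turns x⁻¹θ(xy)θ(x/y) into a 2×2
determinant in x and y (`thetaJ_mul_div`), so Weierstrass's three-term relation is a Plücker
relation (`thetaD_three_term`). Differentiating it at a simple zero of one factor gives
`rho_four_term`: a combination of four logarithmic derivatives of θ is a quotient of theta products.
These logarithmic derivatives are Lambert series over residue classes. With nome q^15 and arguments
-q^a the signs reproduce the character modulo 15 and the quotient is P; with nome q^5 and arguments
w q^a, w a primitive sixth root of unity, they reproduce the character modulo 5 and the quotient is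
Q.

Theta products. Put A = φ(-q)φ(-q^15) and B = φ(-q^3)φ(-q^5). Parity dissections and unimodular
changes of variables in double series give four identities between products of φ and ψ:
`Psi_add_Psi_neg`, `Psi_sub_Psi_neg`, `phi_neg_three_five`, `phi_neg_one_fifteen`. The duplication
formulas turn them into four polynomial equations, and elimination (`modular_relations`) yields P (B
- A) = Q (A + B) and (A + B)² (B - A) = 8 P² Q, hence (A + B)³ = (2P)³. The elimination divides by a
quantity that is nonzero near q = 0. There A + B and 2P are both close to 2, so they agree; the
identity theorem extends A + B = 2P to the disc, and B - A = 2Q follows. -/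

namespace RamanujanLambert

/-! ### Double series over pairs of integers; convergence of the theta series -/

/-- Splitting a double sum according to the parity of the second index. -/
theorem tsum_split_snd {F : ℤ × ℤ → ℂ} (hF : Summable F) :
    ∑' p, F p = ∑' p : ℤ × ℤ, F (p.1, 2 * p.2) + ∑' p : ℤ × ℤ, F (p.1, 2 * p.2 + 1) := by
  have i0 : Function.Injective fun p : ℤ × ℤ => (p.1, 2 * p.2) := by
    rintro ⟨a, b⟩ ⟨c, d⟩ h
    simp only [Prod.mk.injEq] at h ⊢
    omega
  have i1 : Function.Injective fun p : ℤ × ℤ => (p.1, 2 * p.2 + 1) := by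
    rintro ⟨a, b⟩ ⟨c, d⟩ h
    simp only [Prod.mk.injEq] at h ⊢
    omega
  have h0 := (i0.hasSum_range_iff (f := F)).2 (hF.comp_injective i0).hasSum
  have h1 := (i1.hasSum_range_iff (f := F)).2 (hF.comp_injective i1).hasSum
  refine HasSum.tsum_eq (HasSum.add_isCompl ⟨?_, ?_⟩ h0 h1)
  · rw [Set.disjoint_iff]
    rintro _ ⟨⟨⟨a, b⟩, rfl⟩, ⟨⟨c, d⟩, h⟩⟩
    simp only [Prod.mk.injEq] at h
    omega
  · refine codisjoint_iff.2 (Set.eq_univ_of_forall ?_)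
    rintro ⟨a, b⟩
    rcases Int.even_or_odd' b with ⟨c, rfl | rfl⟩
    · exact Or.inl ⟨(a, c), rfl⟩
    · exact Or.inr ⟨(a, c), rfl⟩

/-- The shear `(n, s) ↦ (n + s, n)`. -/
def shear : ℤ × ℤ ≃ ℤ × ℤ where
  toFun p := (p.1 + p.2, p.1)
  invFun p := (p.2, p.1 - p.2)
  left_inv p := by ext <;> simp
  right_inv p := by ext <;> simp

/-- Splitting a double sum according to the parity of the sum of the indices. -/
theorem tsum_split_parity {F : ℤ × ℤ → ℂ} (hF : Summable F) :
    ∑' p, F p = ∑' p : ℤ × ℤ, F (p.1 + 2 * p.2, p.1)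
      + ∑' p : ℤ × ℤ, F (p.1 + (2 * p.2 + 1), p.1) := by
  rw [← shear.tsum_eq, tsum_split_snd (F := fun p => F (shear p))
    ((shear.summable_iff (f := F)).2 hF)]
  rfl

theorem two_mul_tri (n : ℤ) : 2 * (n * (n - 1) / 2) = n * (n - 1) :=
  Int.mul_ediv_cancel' (Int.even_mul_pred_self n).two_dvd

theorem tri_succ (n : ℤ) : (n + 1) * (n + 1 - 1) / 2 = n * (n - 1) / 2 + n := by
  have h1 := two_mul_tri n
  have h2 := two_mul_tri (n + 1)
  have : (n + 1) * (n + 1 - 1) = n * (n - 1) + 2 * n := by ring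
  omega

theorem tri_neg (n : ℤ) : -n * (-n - 1) / 2 = n * (n - 1) / 2 + n := by
  rw [← tri_succ]; congr 1; ring

/-- The ratio of consecutive terms is r^n c, which tends to 0 however large c is. -/
theorem summable_nat_pow_tri {r c : ℝ} (hr : 0 < r) (hr1 : r < 1) (hc : 0 < c) :
    Summable fun n : ℕ => r ^ ((n : ℤ) * (n - 1) / 2) * c ^ (n : ℤ) := by
  refine summable_of_ratio_test_tendsto_lt_one (l := 0) one_pos
    (Filter.Eventually.of_forall fun n => by positivity) ?_
  have h : ∀ n : ℕ, ‖r ^ (((n + 1 : ℕ) : ℤ) * (((n + 1 : ℕ) : ℤ) - 1) / 2) * c ^ ((n + 1 : ℕ) : ℤ)‖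
      / ‖r ^ ((n : ℤ) * (n - 1) / 2) * c ^ (n : ℤ)‖ = r ^ n * c := by
    intro n
    rw [Real.norm_of_nonneg (by positivity), Real.norm_of_nonneg (by positivity)]
    push_cast
    rw [tri_succ, zpow_add₀ hr.ne', zpow_add_one₀ hc.ne', zpow_natCast]
    have : r ^ ((n : ℤ) * (n - 1) / 2) ≠ 0 := by positivity
    have : c ^ (n : ℤ) ≠ 0 := by positivity
    field_simp
  simp only [h]
  simpa using (tendsto_pow_atTop_nhds_zero_of_lt_one hr.le hr1).mul_const c

/-- Absolute convergence of the theta series. -/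
theorem summable_norm_theta {Q z : ℂ} (hQ0 : Q ≠ 0) (hQ : ‖Q‖ < 1) (hz : z ≠ 0) :
    Summable fun n : ℤ => ‖Q ^ (n * (n - 1) / 2) * z ^ n‖ := by
  have hr : 0 < ‖Q‖ := norm_pos_iff.2 hQ0
  have hc : 0 < ‖z‖ := norm_pos_iff.2 hz
  simp only [norm_mul, norm_zpow]
  refine Summable.of_nat_of_neg (summable_nat_pow_tri hr hQ hc) ?_
  -- On the negative half, n ↦ -n replaces c = ‖z‖ by r / c, since the triangular exponent gains n.
  refine (summable_nat_pow_tri hr hQ (mul_pos hr (inv_pos.2 hc))).congr fun n => ?_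
  rw [tri_neg, zpow_add₀ hr.ne', mul_zpow, zpow_neg, inv_zpow, mul_assoc]

/-- The theta function `∑ (-1) ^ n Q ^ (n (n - 1) / 2) z ^ n`. -/
noncomputable def thetaJ (Q z : ℂ) : ℂ := ∑' n : ℤ, Q ^ (n * (n - 1) / 2) * (-z) ^ n

end RamanujanLambert

/-! ### The Jacobi triple product, as a limit of the `q`-binomial theorem -/

namespace RamanujanLambert

open Filter Topology

/-- The Gaussian binomial coefficients. -/
def gaussBinom (Q : ℂ) : ℕ → ℕ → ℂ
  | 0, 0 => 1
  | 0, _ + 1 => 0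
  | _ + 1, 0 => 1
  -- The truncated subtraction is harmless: for j > M the factor `gaussBinom Q M j` vanishes.
  | M + 1, j + 1 => gaussBinom Q M (j + 1) + Q ^ (M - j) * gaussBinom Q M j

theorem gaussBinom_zero_right (Q : ℂ) (M : ℕ) : gaussBinom Q M 0 = 1 := by
  cases M <;> rfl

theorem gaussBinom_eq_zero (Q : ℂ) {M j : ℕ} (h : M < j) : gaussBinom Q M j = 0 := by
  induction M generalizing j with
  | zero => obtain ⟨j, rfl⟩ := Nat.exists_eq_succ_of_ne_zero (by omega : j ≠ 0); rfl
  | succ M ih =>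
    obtain ⟨j, rfl⟩ := Nat.exists_eq_succ_of_ne_zero (by omega : j ≠ 0)
    rw [Nat.succ_eq_add_one, gaussBinom, ih (by omega), ih (by omega)]
    simp

theorem choose_succ_two (j : ℕ) : (j + 1).choose 2 = j.choose 2 + j := by
  rw [Nat.choose_succ_succ' j 1, Nat.choose_one_right, add_comm]

/-- The `q`-binomial theorem. -/
theorem prod_one_sub_eq_sum_gaussBinom (Q x : ℂ) (M : ℕ) :
    ∏ k ∈ Finset.range M, (1 - x * Q ^ k)
      = ∑ j ∈ Finset.range (M + 1), gaussBinom Q M j * Q ^ j.choose 2 * (-x) ^ j := by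
  induction M with
  | zero => simp [gaussBinom]
  | succ M ih =>
    rw [Finset.prod_range_succ, ih, mul_sub, mul_one, Finset.sum_range_succ' _ (M + 1)]
    have h1 : ∑ j ∈ Finset.range (M + 1), gaussBinom Q M j * Q ^ j.choose 2 * (-x) ^ j
        = ∑ j ∈ Finset.range (M + 1), gaussBinom Q M (j + 1) * Q ^ (j + 1).choose 2 * (-x) ^ (j + 1)
          + 1 := by
      rw [Finset.sum_range_succ' _ M, Finset.sum_range_succ _ M,
        gaussBinom_eq_zero Q (Nat.lt_succ_self M), gaussBinom_zero_right]
      simp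
    have h2 : ∀ j ∈ Finset.range (M + 1),
        gaussBinom Q (M + 1) (j + 1) * Q ^ (j + 1).choose 2 * (-x) ^ (j + 1)
        = gaussBinom Q M (j + 1) * Q ^ (j + 1).choose 2 * (-x) ^ (j + 1)
          - gaussBinom Q M j * Q ^ j.choose 2 * (-x) ^ j * (x * Q ^ M) := by
      intro j hj
      have hj' : j ≤ M := by simpa [Nat.lt_succ_iff] using hj
      have e : Q ^ M = Q ^ (M - j) * Q ^ j := by rw [← pow_add, Nat.sub_add_cancel hj']
      rw [gaussBinom, choose_succ_two, e]
      ring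
    rw [Finset.sum_congr rfl h2, Finset.sum_sub_distrib, ← Finset.sum_mul, h1,
      gaussBinom_zero_right]
    simp
    ring

/-- The finite product `(Q; Q)_m`. -/
def qFac (Q : ℂ) (m : ℕ) : ℂ := ∏ k ∈ Finset.range m, (1 - Q * Q ^ k)

theorem qFac_succ (Q : ℂ) (m : ℕ) : qFac Q (m + 1) = qFac Q m * (1 - Q ^ (m + 1)) := by
  rw [qFac, Finset.prod_range_succ, ← pow_succ']; rfl

theorem one_sub_pow_ne_zero {Q : ℂ} (hQ : ‖Q‖ < 1) {n : ℕ} (hn : n ≠ 0) : 1 - Q ^ n ≠ 0 := by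
  intro h
  have h3 : ‖Q‖ ^ n < 1 := pow_lt_one₀ (norm_nonneg Q) hQ hn
  rw [← norm_pow, ← sub_eq_zero.1 h, norm_one] at h3
  exact lt_irrefl _ h3

theorem qFac_ne_zero {Q : ℂ} (hQ : ‖Q‖ < 1) (m : ℕ) : qFac Q m ≠ 0 := by
  refine Finset.prod_ne_zero_iff.2 fun k _ => ?_
  rw [← pow_succ']
  exact one_sub_pow_ne_zero hQ k.succ_ne_zero

/-- The division-free form lets the induction run without any nonvanishing. The two predecessors
combine through 1 - Q^(s+t) = (1 - Q^s) + Q^s (1 - Q^t). -/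
theorem gaussBinom_mul (Q : ℂ) (i j : ℕ) :
    gaussBinom Q (i + j) j * (qFac Q j * qFac Q i) = qFac Q (i + j) := by
  induction' hM : i + j with M ih generalizing i j
  · obtain ⟨rfl, rfl⟩ : i = 0 ∧ j = 0 := by omega
    simp [gaussBinom, qFac]
  · rcases j with _ | j
    · obtain rfl : i = M + 1 := by omega
      simp [gaussBinom, qFac]
    · have e1 := ih i j (by omega)
      rw [gaussBinom, qFac_succ, qFac_succ Q M, show M - j = i by omega]
      rcases i with _ | i
      · obtain rfl : j = M := by omega
        rw [gaussBinom_eq_zero Q (Nat.lt_succ_self j)]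
        linear_combination (1 - Q ^ (j + 1)) * e1
      · have e2 := ih i (j + 1) (by omega)
        rw [qFac_succ] at e1 e2
        obtain rfl : M = i + 1 + j := by omega
        have : Q ^ (i + 1 + j + 1) = Q ^ (i + 1) * Q ^ (j + 1) := by rw [← pow_add]; congr 1
        rw [this, qFac_succ]
        linear_combination (1 - Q ^ (i + 1)) * e2 + Q ^ (i + 1) * (1 - Q ^ (j + 1)) * e1

theorem gaussBinom_eq {Q : ℂ} (hQ : ‖Q‖ < 1) (i j : ℕ) :
    gaussBinom Q (i + j) j = qFac Q (i + j) / (qFac Q j * qFac Q i) :=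
  eq_div_of_mul_eq (mul_ne_zero (qFac_ne_zero hQ _) (qFac_ne_zero hQ _)) (gaussBinom_mul Q i j)

theorem tendsto_prod_qPochhammerInf (a : ℂ) {Q : ℂ} (hQ : ‖Q‖ < 1) :
    Tendsto (fun m => ∏ k ∈ Finset.range m, (1 - a * Q ^ k)) atTop (𝓝 (qPochhammerInf a Q)) :=
  (multipliable_qPochhammerInf a Q hQ).hasProd.tendsto_prod_nat

theorem tendsto_qFac {Q : ℂ} (hQ : ‖Q‖ < 1) : Tendsto (qFac Q) atTop (𝓝 (E Q)) :=
  tendsto_prod_qPochhammerInf Q hQ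

/-- The coefficient of the finite form of the triple product identity. -/
noncomputable def finCoeff (Q : ℂ) (N : ℕ) (n : ℤ) : ℂ :=
  if n.natAbs ≤ N then qFac Q (2 * N) / (qFac Q (N + n).toNat * qFac Q (N - n).toNat) else 0

/-- The products (Q; Q)_m converge to a nonzero limit, so they and their inverses are bounded. The
bound, uniform in N and n, supplies the majorant for the passage to the limit. -/
theorem exists_bound_finCoeff {Q : ℂ} (hQ : ‖Q‖ < 1) : ∃ C : ℝ, ∀ N n, ‖finCoeff Q N n‖ ≤ C := by
  have h1 := (tendsto_qFac hQ).norm.bddAbove_range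
  have h2 := ((tendsto_qFac hQ).inv₀ (E_ne_zero Q hQ)).norm.bddAbove_range
  obtain ⟨A, hA⟩ := h1
  obtain ⟨B, hB⟩ := h2
  have hA' : ∀ m, ‖qFac Q m‖ ≤ A := fun m => hA ⟨m, rfl⟩
  have hB' : ∀ m, ‖(qFac Q m)⁻¹‖ ≤ B := fun m => hB ⟨m, rfl⟩
  have A0 : 0 ≤ A := (norm_nonneg _).trans (hA' 0)
  have B0 : 0 ≤ B := (norm_nonneg _).trans (hB' 0)
  refine ⟨A * (B * B), fun N n => ?_⟩
  rw [finCoeff]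
  split_ifs
  · rw [div_eq_mul_inv, mul_inv, norm_mul, norm_mul]
    exact mul_le_mul (hA' _) (mul_le_mul (hB' _) (hB' _) (norm_nonneg _) B0) (by positivity) A0
  · simpa using by positivity

theorem tendsto_finCoeff {Q : ℂ} (hQ : ‖Q‖ < 1) (n : ℤ) :
    Tendsto (fun N => finCoeff Q N n) atTop (𝓝 (E Q)⁻¹) := by
  have hE := E_ne_zero Q hQ
  have t0 : Tendsto (fun N : ℕ => 2 * N) atTop atTop := tendsto_id.const_mul_atTop' two_pos
  have t1 : Tendsto (fun N : ℕ => (N + n).toNat) atTop atTop :=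
    tendsto_atTop_atTop.2 fun b => ⟨b + n.natAbs, fun a ha => by omega⟩
  have t2 : Tendsto (fun N : ℕ => (N - n).toNat) atTop atTop :=
    tendsto_atTop_atTop.2 fun b => ⟨b + n.natAbs, fun a ha => by omega⟩
  have := ((tendsto_qFac hQ).comp t0).div (((tendsto_qFac hQ).comp t1).mul
    ((tendsto_qFac hQ).comp t2)) (mul_ne_zero hE hE)
  rw [show E Q / (E Q * E Q) = (E Q)⁻¹ by field_simp] at this
  refine this.congr' ?_
  filter_upwards [eventually_ge_atTop n.natAbs] with N hN
  simp [finCoeff, hN]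

/-- Each factor is 1 - z Q^(-(k+1)) = -z Q^(-(k+1)) (1 - Q^(k+1) / z); the monomials are collected
in front. -/
theorem prod_range_one_sub_neg_pow {Q z : ℂ} (hQ0 : Q ≠ 0) (hz : z ≠ 0) (N : ℕ) :
    ∏ k ∈ Finset.range N, (1 - z * Q ^ (-(k + 1) : ℤ))
      = (∏ k ∈ Finset.range N, (1 - Q / z * Q ^ k)) *
          ((-z) ^ N * Q ^ (-((N + 1 : ℤ) * (N + 1 - 1) / 2))) := by
  induction N with
  | zero => simp
  | succ N ih =>
    have h : ((N + 1 : ℕ) : ℤ) = N + 1 := by push_cast; rfl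
    rw [Finset.prod_range_succ, ih, Finset.prod_range_succ, h, tri_succ (N + 1),
      neg_add (((N : ℤ) + 1) * (N + 1 - 1) / 2), zpow_add₀ hQ0, pow_succ, zpow_neg Q (N + 1),
      zpow_add_one₀ hQ0, zpow_natCast]
    have : Q ^ N ≠ 0 := pow_ne_zero _ hQ0
    field_simp
    ring

theorem prod_range_two_mul_shift {Q z : ℂ} (hQ0 : Q ≠ 0) (hz : z ≠ 0) (N : ℕ) :
    ∏ k ∈ Finset.range (2 * N), (1 - z * Q ^ (-N : ℤ) * Q ^ k)
      = (∏ k ∈ Finset.range N, (1 - z * Q ^ k)) *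
        ((∏ k ∈ Finset.range N, (1 - Q / z * Q ^ k)) *
          ((-z) ^ N * Q ^ (-((N + 1 : ℤ) * (N + 1 - 1) / 2)))) := by
  rw [two_mul, Finset.prod_range_add, mul_comm]
  congr 1
  · refine Finset.prod_congr rfl fun k _ => ?_
    rw [mul_assoc, ← zpow_natCast, ← zpow_add₀ hQ0, ← zpow_natCast]
    congr 3
    push_cast
    ring
  · rw [← prod_range_one_sub_neg_pow hQ0 hz, ← Finset.prod_range_reflect]
    refine Finset.prod_congr rfl fun k hk => ?_
    have hk' := Finset.mem_range.1 hk
    rw [mul_assoc, ← zpow_natCast, ← zpow_add₀ hQ0]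
    congr 3
    omega

/-- The finite form of the triple product identity. -/
theorem sum_finCoeff {Q z : ℂ} (hQ0 : Q ≠ 0) (hQ : ‖Q‖ < 1) (hz : z ≠ 0) (N : ℕ) :
    ∑' n : ℤ, finCoeff Q N n * (Q ^ (n * (n - 1) / 2) * (-z) ^ n)
      = (∏ k ∈ Finset.range N, (1 - z * Q ^ k)) * ∏ k ∈ Finset.range N, (1 - Q / z * Q ^ k) := by
  have hz' : -z ≠ 0 := neg_ne_zero.2 hz
  have hne : (-z) ^ N * Q ^ (-((N + 1 : ℤ) * (N + 1 - 1) / 2)) ≠ 0 :=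
    mul_ne_zero (pow_ne_zero _ hz') (zpow_ne_zero _ hQ0)
  -- Multiplied by this monomial, the right side is a product of 2N consecutive factors starting at
  -- z Q^(-N). The `q`-binomial theorem expands it, with summation index j = n + N.
  refine mul_right_cancel₀ hne ?_
  rw [mul_assoc, ← prod_range_two_mul_shift hQ0 hz, prod_one_sub_eq_sum_gaussBinom,
    tsum_eq_sum (s := Finset.Icc (-N : ℤ) N), Finset.sum_mul]
  · refine Finset.sum_nbij' (fun n => (n + N).toNat) (fun j => (j : ℤ) - N) ?_ ?_ ?_ ?_ ?_
    · intro n hn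
      simp only [Finset.mem_Icc, Finset.mem_range] at hn ⊢
      omega
    · intro n hn
      simp only [Finset.mem_Icc, Finset.mem_range] at hn ⊢
      omega
    · intro n hn
      simp only [Finset.mem_Icc] at hn
      omega
    · intro n hn
      omega
    · intro n hn
      simp only [Finset.mem_Icc] at hn
      obtain ⟨j, rfl⟩ : ∃ j : ℕ, n = (j : ℤ) - N := ⟨(n + N).toNat, by omega⟩
      obtain ⟨i, hi⟩ : ∃ i : ℕ, 2 * N = i + j := ⟨2 * N - j, by omega⟩
      have e1 : ((j : ℤ) - N + N).toNat = j := by omega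
      have e2 : ((N : ℤ) + ((j : ℤ) - N)).toNat = j := by omega
      have e3 : ((N : ℤ) - ((j : ℤ) - N)).toNat = i := by omega
      have e4 : ((j : ℤ) - N).natAbs ≤ N := by omega
      rw [e1, finCoeff, if_pos e4, e2, e3, hi, gaussBinom_eq hQ, ← neg_mul, mul_pow,
        zpow_sub₀ hz', zpow_natCast, zpow_natCast]
      have e5 : Q ^ (((j : ℤ) - N) * (j - N - 1) / 2) * Q ^ (-((N + 1 : ℤ) * (N + 1 - 1) / 2))
          = Q ^ j.choose 2 * (Q ^ (-(N : ℤ))) ^ j := by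
        rw [← zpow_natCast, ← zpow_natCast, ← zpow_mul, ← zpow_add₀ hQ0, ← zpow_add₀ hQ0]
        congr 1
        have h1 := two_mul_tri ((j : ℤ) - N)
        have h2 := two_mul_tri ((N : ℤ) + 1)
        have h3 := two_mul_tri (j : ℤ)
        have h4 : ((j.choose 2 : ℕ) : ℤ) = (j : ℤ) * (j - 1) / 2 := by
          rw [Nat.choose_two_right]
          rcases j with _ | j
          · simp
          · push_cast; simp
        rw [h4]
        have : ∀ a b : ℤ, 2 * a = 2 * b → a = b := fun a b h => by omega
        apply this
        linear_combination h1 - h2 - h3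
      have hzN : (-z) ^ N ≠ 0 := pow_ne_zero _ hz'
      field_simp
      linear_combination (qFac Q (i + j) / (qFac Q j * qFac Q i)) * e5
  · intro n hn
    rw [finCoeff, if_neg, zero_mul]
    simp only [Finset.mem_Icc] at hn
    omega

/-- The Jacobi triple product identity. -/
theorem thetaJ_eq {Q z : ℂ} (hQ0 : Q ≠ 0) (hQ : ‖Q‖ < 1) (hz : z ≠ 0) :
    thetaJ Q z = E Q * (qPochhammerInf z Q * qPochhammerInf (Q / z) Q) := by
  obtain ⟨C, hC⟩ := exists_bound_finCoeff hQ
  have hs := (summable_norm_theta hQ0 hQ (neg_ne_zero.2 hz)).mul_left C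
  -- Tannery's theorem: each coefficient tends to 1 / E(Q), under the majorant C times the absolute
  -- theta series.
  have h1 := tendsto_tsum_of_dominated_convergence (𝓕 := atTop) hs
    (fun n => (tendsto_finCoeff hQ n).mul_const (Q ^ (n * (n - 1) / 2) * (-z) ^ n))
    (Eventually.of_forall fun N n => by
      rw [norm_mul]
      exact mul_le_mul_of_nonneg_right (hC N n) (norm_nonneg _))
  simp only [sum_finCoeff hQ0 hQ hz] at h1
  have h2 := (tendsto_prod_qPochhammerInf z hQ).mul (tendsto_prod_qPochhammerInf (Q / z) hQ)
  have h3 := tendsto_nhds_unique h1 h2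
  rw [tsum_mul_left] at h3
  rw [← h3, ← mul_assoc, mul_inv_cancel₀ (E_ne_zero Q hQ), one_mul]
  rfl

end RamanujanLambert

/-! ### Products of two theta functions and the three-term relation -/

namespace RamanujanLambert

theorem summable_norm_thetaJ {Q z : ℂ} (hQ0 : Q ≠ 0) (hQ : ‖Q‖ < 1) (hz : z ≠ 0) :
    Summable fun n : ℤ => ‖Q ^ (n * (n - 1) / 2) * (-z) ^ n‖ :=
  summable_norm_theta hQ0 hQ (neg_ne_zero.2 hz)

theorem thetaJ_mul_thetaJ {Q R x y : ℂ} (hQ0 : Q ≠ 0) (hQ : ‖Q‖ < 1) (hR0 : R ≠ 0) (hR : ‖R‖ < 1)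
    (hx : x ≠ 0) (hy : y ≠ 0) :
    thetaJ Q x * thetaJ R y = ∑' p : ℤ × ℤ,
      Q ^ (p.1 * (p.1 - 1) / 2) * (-x) ^ p.1 * (R ^ (p.2 * (p.2 - 1) / 2) * (-y) ^ p.2) :=
  tsum_mul_tsum_of_summable_norm (summable_norm_thetaJ hQ0 hQ hx) (summable_norm_thetaJ hR0 hR hy)

theorem summable_thetaJ_mul {Q R x y : ℂ} (hQ0 : Q ≠ 0) (hQ : ‖Q‖ < 1) (hR0 : R ≠ 0)
    (hR : ‖R‖ < 1) (hx : x ≠ 0) (hy : y ≠ 0) :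
    Summable fun p : ℤ × ℤ =>
      Q ^ (p.1 * (p.1 - 1) / 2) * (-x) ^ p.1 * (R ^ (p.2 * (p.2 - 1) / 2) * (-y) ^ p.2) :=
  summable_mul_of_summable_norm (f := fun m : ℤ => Q ^ (m * (m - 1) / 2) * (-x) ^ m)
    (g := fun n : ℤ => R ^ (n * (n - 1) / 2) * (-y) ^ n)
    (summable_norm_thetaJ hQ0 hQ hx) (summable_norm_thetaJ hR0 hR hy)

theorem thetaJ_sq_neg (Q x : ℂ) :
    thetaJ (Q ^ 2) (-x ^ 2) = ∑' i : ℤ, Q ^ (i * (i - 1)) * x ^ (2 * i) := by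
  refine tsum_congr fun i => ?_
  rw [neg_neg, ← zpow_natCast, ← zpow_natCast, ← zpow_mul, ← zpow_mul]
  congr 2
  exact two_mul_tri i

theorem thetaJ_sq_neg_mul {Q : ℂ} (hQ0 : Q ≠ 0) (x : ℂ) :
    thetaJ (Q ^ 2) (-(Q * x ^ 2)) = ∑' i : ℤ, Q ^ (i * i) * x ^ (2 * i) := by
  refine tsum_congr fun i => ?_
  rw [neg_neg, mul_zpow, ← zpow_natCast, ← zpow_natCast, ← zpow_mul, ← zpow_mul, ← mul_assoc,
    ← zpow_add₀ hQ0]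
  congr 2
  have := two_mul_tri i
  push_cast
  linear_combination this

theorem norm_sq_lt_one {Q : ℂ} (hQ : ‖Q‖ < 1) : ‖Q ^ 2‖ < 1 := by
  rw [norm_pow]; exact pow_lt_one₀ (norm_nonneg Q) hQ two_ne_zero

/-- The equivalence `(i, j) ↦ (i - j, j)`. -/
def shearSub : ℤ × ℤ ≃ ℤ × ℤ where
  toFun p := (p.1 - p.2, p.2)
  invFun p := (p.1 + p.2, p.2)
  left_inv p := by ext <;> simp
  right_inv p := by ext <;> simp

theorem summable_norm_sq {Q x : ℂ} (hQ0 : Q ≠ 0) (hQ : ‖Q‖ < 1) (hx : x ≠ 0) :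
    Summable fun i : ℤ => ‖Q ^ (i * (i - 1)) * x ^ (2 * i)‖ := by
  refine (summable_norm_theta (pow_ne_zero 2 hQ0) (norm_sq_lt_one hQ)
    (pow_ne_zero 2 hx)).congr fun i => ?_
  rw [← zpow_natCast, ← zpow_natCast, ← zpow_mul, ← zpow_mul]
  congr 3
  exact two_mul_tri i

theorem summable_norm_sq_mul {Q x : ℂ} (hQ0 : Q ≠ 0) (hQ : ‖Q‖ < 1) (hx : x ≠ 0) :
    Summable fun i : ℤ => ‖Q ^ (i * i) * x ^ (2 * i)‖ := by
  refine (summable_norm_theta (pow_ne_zero 2 hQ0) (norm_sq_lt_one hQ)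
    (mul_ne_zero hQ0 (pow_ne_zero 2 hx))).congr fun i => ?_
  rw [mul_zpow, ← zpow_natCast, ← zpow_natCast, ← zpow_mul, ← zpow_mul, ← mul_assoc,
    ← zpow_add₀ hQ0]
  congr 3
  have := two_mul_tri i
  push_cast
  linear_combination this

theorem thetaJ_sq_neg_shift {Q y : ℂ} (hy : y ≠ 0) :
    thetaJ (Q ^ 2) (-y ^ 2) = y * ∑' i : ℤ, Q ^ (i * i + i) * y ^ (2 * i + 1) := by
  rw [thetaJ_sq_neg, ← (Equiv.addRight (1 : ℤ)).tsum_eq, ← tsum_mul_left]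
  refine tsum_congr fun i => ?_
  rw [Equiv.coe_addRight, show (i + 1) * (i + 1 - 1) = i * i + i by ring,
    show 2 * (i + 1) = 2 * i + 1 + 1 by ring, zpow_add_one₀ hy]
  ring

/-- The decomposition of `θ(xy) θ(x/y)` into theta functions of the squared nome. -/
theorem thetaJ_mul_div {Q x y : ℂ} (hQ0 : Q ≠ 0) (hQ : ‖Q‖ < 1) (hx : x ≠ 0) (hy : y ≠ 0) :
    thetaJ Q (x * y) * thetaJ Q (x / y)
      = thetaJ (Q ^ 2) (-x ^ 2) * thetaJ (Q ^ 2) (-(Q * y ^ 2))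
        - x / y * (thetaJ (Q ^ 2) (-(Q * x ^ 2)) * thetaJ (Q ^ 2) (-y ^ 2)) := by
  have hxy : x * y ≠ 0 := mul_ne_zero hx hy
  have hxy' : x / y ≠ 0 := div_ne_zero hx hy
  have hsum : Summable fun i : ℤ => ‖Q ^ (i * i + i) * y ^ (2 * i + 1)‖ := by
    have := (Equiv.addRight (1 : ℤ)).summable_iff.2 (summable_norm_sq hQ0 hQ hy)
    refine (this.mul_left ‖y⁻¹‖).congr fun i => ?_
    rw [Function.comp, Equiv.coe_addRight, ← norm_mul,
      show (i + 1) * (i + 1 - 1) = i * i + i by ring,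
      show 2 * (i + 1) = 2 * i + 1 + 1 by ring, zpow_add_one₀ hy]
    congr 1
    field_simp
  have e1 : -(x * y) = -1 * x * y := by ring
  have e2 : -(x / y) = -1 * x * y⁻¹ := by ring
  rw [thetaJ_mul_thetaJ hQ0 hQ hQ0 hQ hxy hxy',
    tsum_split_parity (summable_thetaJ_mul hQ0 hQ hQ0 hQ hxy hxy'), sub_eq_add_neg]
  congr 1
  -- Indices of equal parity are i + j and i - j; their triangular numbers add up to i(i-1) + j²,
  -- which separates the variables.
  · rw [thetaJ_sq_neg, thetaJ_sq_neg_mul hQ0, tsum_mul_tsum_of_summable_norm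
      (summable_norm_sq hQ0 hQ hx) (summable_norm_sq_mul hQ0 hQ hy), ← shearSub.tsum_eq]
    refine tsum_congr fun ⟨i, j⟩ => ?_
    simp only [shearSub, Equiv.coe_fn_mk, e1, e2, mul_zpow, inv_zpow']
    have h1 := two_mul_tri (i - j + 2 * j)
    have h2 := two_mul_tri (i - j)
    generalize (i - j + 2 * j) * (i - j + 2 * j - 1) / 2 = a at *
    generalize (i - j) * (i - j - 1) / 2 = b at *
    have hab : a + b = i * (i - 1) + j * j := by
      have : 2 * (a + b) = 2 * (i * (i - 1) + j * j) := by linear_combination h1 + h2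
      omega
    have s1 : (-1 : ℂ) ^ (i - j + 2 * j) * (-1) ^ (i - j) = 1 := by
      rw [← zpow_add₀ (by norm_num), show i - j + 2 * j + (i - j) = 2 * i by ring, zpow_mul]
      norm_num
    have s2 : x ^ (i - j + 2 * j) * x ^ (i - j) = x ^ (2 * i) := by
      rw [← zpow_add₀ hx]; congr 1; ring
    have s3 : y ^ (i - j + 2 * j) * y ^ (-(i - j)) = y ^ (2 * j) := by
      rw [← zpow_add₀ hy]; congr 1; ring
    have s4 : Q ^ a * Q ^ b = Q ^ (i * (i - 1)) * Q ^ (j * j) := by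
      rw [← zpow_add₀ hQ0, hab, zpow_add₀ hQ0]
    calc _ = (Q ^ a * Q ^ b) * ((-1 : ℂ) ^ (i - j + 2 * j) * (-1) ^ (i - j))
          * (x ^ (i - j + 2 * j) * x ^ (i - j)) * (y ^ (i - j + 2 * j) * y ^ (-(i - j))) := by ring
      _ = _ := by rw [s1, s2, s3, s4]; ring
  -- Indices of opposite parity are i + j + 1 and i - j, with exponent i² + (j² + j). The total sign
  -- is -1 and a spare factor x appears.
  · rw [thetaJ_sq_neg_shift hy, thetaJ_sq_neg_mul hQ0, mul_left_comm _ y, ← mul_assoc,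
      div_mul_cancel₀ _ hy, tsum_mul_tsum_of_summable_norm
      (summable_norm_sq_mul hQ0 hQ hx) hsum, ← shearSub.tsum_eq, ← tsum_mul_left, ← tsum_neg]
    refine tsum_congr fun ⟨i, j⟩ => ?_
    simp only [shearSub, Equiv.coe_fn_mk, e1, e2, mul_zpow, inv_zpow']
    have h1 := two_mul_tri (i - j + (2 * j + 1))
    have h2 := two_mul_tri (i - j)
    generalize (i - j + (2 * j + 1)) * (i - j + (2 * j + 1) - 1) / 2 = a at *
    generalize (i - j) * (i - j - 1) / 2 = b at *
    have hab : a + b = i * i + (j * j + j) := by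
      have : 2 * (a + b) = 2 * (i * i + (j * j + j)) := by linear_combination h1 + h2
      omega
    have s1 : (-1 : ℂ) ^ (i - j + (2 * j + 1)) * (-1) ^ (i - j) = -1 := by
      rw [← zpow_add₀ (by norm_num), show i - j + (2 * j + 1) + (i - j) = 2 * i + 1 by ring,
        zpow_add_one₀ (by norm_num), zpow_mul]
      norm_num
    have s2 : x ^ (i - j + (2 * j + 1)) * x ^ (i - j) = x ^ (2 * i) * x := by
      rw [← zpow_add₀ hx, ← zpow_add_one₀ hx]; congr 1; ring
    have s3 : y ^ (i - j + (2 * j + 1)) * y ^ (-(i - j)) = y ^ (2 * j + 1) := by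
      rw [← zpow_add₀ hy]; congr 1; ring
    have s4 : Q ^ a * Q ^ b = Q ^ (i * i) * Q ^ (j * j + j) := by
      rw [← zpow_add₀ hQ0, hab, zpow_add₀ hQ0]
    calc _ = (Q ^ a * Q ^ b) * ((-1 : ℂ) ^ (i - j + (2 * j + 1)) * (-1) ^ (i - j))
          * (x ^ (i - j + (2 * j + 1)) * x ^ (i - j))
          * (y ^ (i - j + (2 * j + 1)) * y ^ (-(i - j))) := by ring
      _ = _ := by rw [s1, s2, s3, s4]; ring

/-- The normalised product `x⁻¹ θ(xy) θ(x/y)`. -/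
noncomputable def thetaD (Q x y : ℂ) : ℂ := x⁻¹ * (thetaJ Q (x * y) * thetaJ Q (x / y))

/-- The three-term relation of Weierstrass. -/
theorem thetaD_three_term {Q x y u v : ℂ} (hQ0 : Q ≠ 0) (hQ : ‖Q‖ < 1) (hx : x ≠ 0) (hy : y ≠ 0)
    (hu : u ≠ 0) (hv : v ≠ 0) :
    thetaD Q x y * thetaD Q u v - thetaD Q x v * thetaD Q u y = thetaD Q x u * thetaD Q y v := by
  -- With a(x) = x⁻¹ θ(-x²) and b(x) = θ(-Qx²), both of nome Q², each D(x, y) is a(x) b(y) - b(x)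
  -- a(y). The claim is the Plücker relation for the 2×2 minors of a 2×4 matrix.
  simp only [thetaD, thetaJ_mul_div hQ0 hQ hx hy, thetaJ_mul_div hQ0 hQ hx hu,
    thetaJ_mul_div hQ0 hQ hx hv, thetaJ_mul_div hQ0 hQ hu hy, thetaJ_mul_div hQ0 hQ hu hv,
    thetaJ_mul_div hQ0 hQ hy hv]
  field_simp
  ring

end RamanujanLambert

/-! ### Logarithmic derivatives of theta functions -/

namespace RamanujanLambert

open Filter Topology

theorem summable_norm_mul_pow (a : ℂ) {Q : ℂ} (hQ : ‖Q‖ < 1) :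
    Summable fun n : ℕ => ‖-(a * Q ^ n)‖ := by
  simp only [norm_neg, norm_mul, norm_pow]
  exact (summable_geometric_of_lt_one (norm_nonneg Q) hQ).mul_left _

theorem qPochhammerInf_ne_zero {a Q : ℂ} (hQ : ‖Q‖ < 1) (h : ∀ n : ℕ, 1 - a * Q ^ n ≠ 0) :
    qPochhammerInf a Q ≠ 0 := by
  have := tprod_one_add_ne_zero_of_summable (f := fun n : ℕ => -(a * Q ^ n))
    (fun n => by simpa [sub_eq_add_neg] using h n) (summable_norm_mul_pow a hQ)
  simpa [qPochhammerInf, sub_eq_add_neg] using this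

/-- On a compact set with |a| ≤ C the factors differ from 1 by at most C |Q|^n. Local uniformity is
what permits termwise logarithmic differentiation. -/
theorem multipliableLocallyUniformlyOn_qPochhammerInf {Q : ℂ} (hQ : ‖Q‖ < 1) :
    MultipliableLocallyUniformlyOn (fun (n : ℕ) (a : ℂ) => 1 - a * Q ^ n) Set.univ := by
  use fun a => ∏' n : ℕ, (1 - a * Q ^ n)
  simp_rw [sub_eq_add_neg]
  apply hasProdLocallyUniformlyOn_of_forall_compact isOpen_univ
  intro K _ hcK
  obtain ⟨C, hC⟩ := hcK.isBounded.exists_norm_le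
  refine ((summable_geometric_of_lt_one (norm_nonneg Q) hQ).mul_left C).hasProdUniformlyOn_nat_one_add
    hcK (.of_forall fun n x hx => ?_) (fun _ => by fun_prop)
  rw [norm_neg, norm_mul, norm_pow]
  exact mul_le_mul_of_nonneg_right (hC x hx) (by positivity)

theorem differentiable_qPochhammerInf {Q : ℂ} (hQ : ‖Q‖ < 1) :
    Differentiable ℂ fun a => qPochhammerInf a Q := by
  rw [← differentiableOn_univ]
  exact (multipliableLocallyUniformlyOn_qPochhammerInf hQ).hasProdLocallyUniformlyOn.differentiableOn
    (.of_forall fun _ => by simpa [Finset.prod_fn] using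
      DifferentiableOn.finsetProd (fun _ _ => by fun_prop)) isOpen_univ

theorem one_sub_mul_pow_eventually (a : ℂ) {Q : ℂ} (hQ : ‖Q‖ < 1) :
    ∀ᶠ n : ℕ in atTop, 1 / 2 ≤ ‖1 - a * Q ^ n‖ := by
  have h : Tendsto (fun n : ℕ => ‖1 - a * Q ^ n‖) atTop (𝓝 ‖(1 : ℂ) - a * 0‖) :=
    (((tendsto_pow_atTop_nhds_zero_of_norm_lt_one hQ).const_mul a).const_sub 1).norm
  rw [mul_zero, sub_zero, norm_one] at h
  exact h.eventually_const_le (by norm_num)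

theorem summable_norm_lambert (a b : ℂ) {Q : ℂ} (hQ : ‖Q‖ < 1) :
    Summable fun n : ℕ => ‖b * Q ^ n / (1 - a * Q ^ n)‖ := by
  refine Summable.of_norm_bounded_eventually_nat
    (g := fun n : ℕ => 2 * ‖b‖ * ‖Q‖ ^ n)
    ((summable_geometric_of_lt_one (norm_nonneg Q) hQ).mul_left _) ?_
  filter_upwards [one_sub_mul_pow_eventually a hQ] with n hn
  rw [norm_norm, norm_div, norm_mul, norm_pow, div_le_iff₀ (by linarith)]
  have : 0 ≤ ‖b‖ * ‖Q‖ ^ n := by positivity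
  nlinarith

theorem summable_lambert (a b : ℂ) {Q : ℂ} (hQ : ‖Q‖ < 1) :
    Summable fun n : ℕ => b * Q ^ n / (1 - a * Q ^ n) :=
  (summable_norm_lambert a b hQ).of_norm

theorem hasDerivAt_qPochhammerInf {a Q : ℂ} (hQ : ‖Q‖ < 1) (h : ∀ n : ℕ, 1 - a * Q ^ n ≠ 0) :
    HasDerivAt (fun a => qPochhammerInf a Q)
      (-(∑' n : ℕ, 1 * Q ^ n / (1 - a * Q ^ n)) * qPochhammerInf a Q) a := by
  have hne := qPochhammerInf_ne_zero hQ h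
  have hl : ∀ n : ℕ, logDeriv (fun a : ℂ => 1 - a * Q ^ n) a = -(1 * Q ^ n / (1 - a * Q ^ n)) := by
    intro n
    have : HasDerivAt (fun a : ℂ => 1 - a * Q ^ n) (-(1 * Q ^ n)) a :=
      ((hasDerivAt_id a).mul_const (Q ^ n)).const_sub 1
    rw [logDeriv_apply, this.deriv, neg_div]
  have key := logDeriv_tprod_eq_tsum (f := fun (n : ℕ) (a : ℂ) => 1 - a * Q ^ n) isOpen_univ
    (Set.mem_univ a) h (fun n => by fun_prop)
    (by simpa only [hl] using (summable_lambert a 1 hQ).neg)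
    (multipliableLocallyUniformlyOn_qPochhammerInf hQ) hne
  simp only [hl, tsum_neg] at key
  rw [← key]
  have hd := ((differentiable_qPochhammerInf hQ) a).hasDerivAt
  exact hd.congr_deriv (div_mul_cancel₀ _ hne).symm

/-- The Lambert series `∑ (z Q ^ n / (1 - z Q ^ n) - z⁻¹ Q ^ (n + 1) / (1 - z⁻¹ Q ^ (n + 1)))`,
which is minus the logarithmic derivative of the theta function. -/
noncomputable def rho (Q z : ℂ) : ℂ :=
  ∑' n : ℕ, z * Q ^ n / (1 - z * Q ^ n) - ∑' n : ℕ, Q / z * Q ^ n / (1 - Q / z * Q ^ n)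

/-- `z` is not a zero of the theta function of nome `Q`. -/
def NonZero (Q z : ℂ) : Prop :=
  z ≠ 0 ∧ (∀ n : ℕ, 1 - z * Q ^ n ≠ 0) ∧ ∀ n : ℕ, 1 - Q / z * Q ^ n ≠ 0

theorem hasDerivAt_thetaJ {Q z : ℂ} (hQ0 : Q ≠ 0) (hQ : ‖Q‖ < 1) (hz : NonZero Q z) :
    HasDerivAt (thetaJ Q) (-rho Q z / z * thetaJ Q z) z := by
  obtain ⟨hz0, h1, h2⟩ := hz
  have d1 := hasDerivAt_qPochhammerInf hQ h1
  have d2 : HasDerivAt (fun z : ℂ => Q / z) (-(Q / z ^ 2)) z := by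
    simpa [div_eq_mul_inv] using (hasDerivAt_inv hz0).const_mul Q
  have d3 := (hasDerivAt_qPochhammerInf hQ h2).comp z d2
  have d4 := (d1.mul d3).const_mul (E Q)
  have e : thetaJ Q =ᶠ[𝓝 z] fun z => E Q * (qPochhammerInf z Q * qPochhammerInf (Q / z) Q) := by
    filter_upwards [isOpen_ne.mem_nhds hz0] with w hw
    exact thetaJ_eq hQ0 hQ hw
  refine (d4.congr_of_eventuallyEq e).congr_deriv ?_
  rw [thetaJ_eq hQ0 hQ hz0, rho]
  have s1 : ∑' n : ℕ, z * Q ^ n / (1 - z * Q ^ n) = z * ∑' n : ℕ, 1 * Q ^ n / (1 - z * Q ^ n) := by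
    rw [← tsum_mul_left]; exact tsum_congr fun n => by ring
  have s2 : ∑' n : ℕ, Q / z * Q ^ n / (1 - Q / z * Q ^ n)
      = Q / z * ∑' n : ℕ, 1 * Q ^ n / (1 - Q / z * Q ^ n) := by
    rw [← tsum_mul_left]; exact tsum_congr fun n => by ring
  rw [s1, s2]
  simp only [Function.comp]
  field_simp
  ring_nf

theorem qPochhammerInf_eq_mul (a : ℂ) {Q : ℂ} (hQ : ‖Q‖ < 1) :
    qPochhammerInf a Q = (1 - a) * qPochhammerInf (a * Q) Q := by
  have h := (multipliable_qPochhammerInf (a * Q) Q hQ)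
  rw [qPochhammerInf, tprod_eq_zero_mul']
  · simp only [pow_zero, mul_one, qPochhammerInf, pow_succ', ← mul_assoc]
  · simpa only [pow_succ', ← mul_assoc] using h

/-- The factor 1 - z of the triple product vanishes at 1, so the derivative is minus the remaining
product there, which is E(Q) three times. -/
theorem hasDerivAt_thetaJ_one {Q : ℂ} (hQ0 : Q ≠ 0) (hQ : ‖Q‖ < 1) :
    HasDerivAt (thetaJ Q) (-E Q ^ 3) 1 := by
  have d1 : DifferentiableAt ℂ (fun z => E Q * (qPochhammerInf (z * Q) Q *
      qPochhammerInf (Q / z) Q)) 1 := by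
    have h := differentiable_qPochhammerInf hQ
    have h1 : DifferentiableAt ℂ (fun z => qPochhammerInf (z * Q) Q) 1 :=
      (h _).comp (1 : ℂ) (by fun_prop)
    have h2 : DifferentiableAt ℂ (fun z => qPochhammerInf (Q / z) Q) 1 :=
      DifferentiableAt.comp (g := fun a => qPochhammerInf a Q) (1 : ℂ) (h _)
        ((differentiableAt_const _).div differentiableAt_id one_ne_zero)
    fun_prop
  have d2 := ((hasDerivAt_id (1 : ℂ)).const_sub 1).mul d1.hasDerivAt
  have e : thetaJ Q =ᶠ[𝓝 1] fun z => (1 - z) *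
      (E Q * (qPochhammerInf (z * Q) Q * qPochhammerInf (Q / z) Q)) := by
    filter_upwards [isOpen_ne.mem_nhds one_ne_zero] with w hw
    rw [thetaJ_eq hQ0 hQ hw, qPochhammerInf_eq_mul w hQ]
    ring
  refine (d2.congr_of_eventuallyEq e).congr_deriv ?_
  simp only [id, one_mul, div_one, sub_self, zero_mul, add_zero]
  change -1 * (E Q * (E Q * E Q)) = _
  ring

theorem hasDerivAt_thetaD {Q x y : ℂ} (hQ0 : Q ≠ 0) (hQ : ‖Q‖ < 1) (hx : x ≠ 0) (hy : y ≠ 0)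
    (h1 : NonZero Q (x * y)) (h2 : NonZero Q (x / y)) :
    HasDerivAt (fun x => thetaD Q x y)
      (-(1 + rho Q (x * y) + rho Q (x / y)) / x * thetaD Q x y) x := by
  have d1 := (hasDerivAt_thetaJ hQ0 hQ h1).comp x ((hasDerivAt_id x).mul_const y)
  have d2 := (hasDerivAt_thetaJ hQ0 hQ h2).comp x ((hasDerivAt_id x).div_const y)
  refine ((hasDerivAt_inv hx).mul (d1.mul d2)).congr_deriv ?_
  simp only [Pi.mul_apply, Function.comp, thetaD, id]
  field_simp
  ring

/-- Since θ(1) = 0, only the term that differentiates θ(w / x) survives at w = x. -/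
theorem hasDerivAt_thetaD_self {Q x : ℂ} (hQ0 : Q ≠ 0) (hQ : ‖Q‖ < 1) (hx : x ≠ 0)
    (h1 : DifferentiableAt ℂ (thetaJ Q) (x * x)) :
    HasDerivAt (fun w => thetaD Q w x) (-E Q ^ 3 * thetaJ Q (x * x) / x ^ 2) x := by
  have d1 := HasDerivAt.comp (h₂ := thetaJ Q) (h := fun w => id w * x) x
    h1.hasDerivAt ((hasDerivAt_id x).mul_const x)
  have d2 : HasDerivAt (thetaJ Q ∘ fun w => w / x) (-E Q ^ 3 * (1 / x)) x := by
    refine HasDerivAt.comp x ?_ ((hasDerivAt_id x).div_const x)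
    change HasDerivAt (thetaJ Q) _ (x / x)
    rw [div_self hx]
    exact hasDerivAt_thetaJ_one hQ0 hQ
  have h0 : thetaJ Q 1 = 0 := by
    rw [thetaJ_eq hQ0 hQ one_ne_zero, qPochhammerInf_eq_mul 1 hQ]; simp
  refine ((hasDerivAt_inv hx).mul (d1.mul d2)).congr_deriv ?_
  simp only [Pi.mul_apply, Function.comp, id, div_self hx, h0]
  field_simp
  ring

/-- The four-term identity for logarithmic derivatives of theta functions. -/
theorem rho_four_term {Q x y v : ℂ} (hQ0 : Q ≠ 0) (hQ : ‖Q‖ < 1) (hx : x ≠ 0) (hy : y ≠ 0)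
    (hv : v ≠ 0) (h0 : NonZero Q (x * x)) (h1 : NonZero Q (x * y)) (h2 : NonZero Q (x / y))
    (h3 : NonZero Q (x * v)) (h4 : NonZero Q (x / v)) :
    (rho Q (x * y) + rho Q (x / y) - rho Q (x * v) - rho Q (x / v)) * (y *
      (thetaJ Q (x * y) * thetaJ Q (x / y) * (thetaJ Q (x * v) * thetaJ Q (x / v))))
      = x * E Q ^ 3 * (thetaJ Q (x * x) * thetaJ Q (y * v) * thetaJ Q (y / v)) := by
  have a1 := (hasDerivAt_thetaD hQ0 hQ hx hy h1 h2).mul_const (thetaD Q x v)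
  have a2 := (hasDerivAt_thetaD hQ0 hQ hx hv h3 h4).mul_const (thetaD Q x y)
  have a3 := (hasDerivAt_thetaD_self hQ0 hQ hx
    (hasDerivAt_thetaJ hQ0 hQ h0).differentiableAt).mul_const (thetaD Q y v)
  -- The three-term relation with its third argument frozen at x, read as an identity in w. At w = x
  -- the left side differentiates to logarithmic derivatives, and the right side contributes θ'(1)
  -- because D(x, x) = 0.
  have e : (fun w => thetaD Q w y * thetaD Q x v - thetaD Q w v * thetaD Q x y)
      =ᶠ[𝓝 x] fun w => thetaD Q w x * thetaD Q y v := by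
    filter_upwards [isOpen_ne.mem_nhds hx] with w hw
    exact thetaD_three_term hQ0 hQ hw hy hx hv
  have key := (a1.sub a2).unique (a3.congr_of_eventuallyEq e)
  simp only [thetaD] at key
  field_simp at key
  rw [← sq x]
  linear_combination -key

end RamanujanLambert

/-! ### Product dissections, quasi-periodicity, nonvanishing, Kronecker symbols -/

namespace RamanujanLambert

open Filter Topology

theorem prod_range_mul_eq (f : ℕ → ℂ) (k m : ℕ) :
    ∏ n ∈ Finset.range (k * m), f n
      = ∏ i ∈ Finset.range k, ∏ j ∈ Finset.range m, f (i + k * j) := by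
  induction m with
  | zero => simp
  | succ m ih =>
    rw [mul_add, mul_one, Finset.prod_range_add, ih, ← Finset.prod_mul_distrib]
    refine Finset.prod_congr rfl fun i _ => ?_
    rw [Finset.prod_range_succ, add_comm i (k * m)]

/-- Splitting an infinite `q`-factorial into residue classes. -/
theorem qPochhammerInf_eq_prod (a : ℂ) {q : ℂ} (hq : ‖q‖ < 1) {k : ℕ} (hk : k ≠ 0) :
    qPochhammerInf a q = ∏ i ∈ Finset.range k, qPochhammerInf (a * q ^ i) (q ^ k) := by
  have hqk : ‖q ^ k‖ < 1 := by
    rw [norm_pow]; exact pow_lt_one₀ (norm_nonneg q) hq hk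
  have t1 : Tendsto (fun m => ∏ n ∈ Finset.range (k * m), (1 - a * q ^ n)) atTop
      (𝓝 (qPochhammerInf a q)) :=
    (tendsto_prod_qPochhammerInf a hq).comp (tendsto_id.const_mul_atTop' (Nat.pos_of_ne_zero hk))
  refine tendsto_nhds_unique t1 ?_
  simp only [prod_range_mul_eq]
  refine tendsto_finsetProd _ fun i _ => ?_
  refine (tendsto_prod_qPochhammerInf (a * q ^ i) hqk).congr fun m => ?_
  refine Finset.prod_congr rfl fun j _ => ?_
  rw [pow_add, pow_mul, mul_assoc]

theorem norm_pow_lt_one {q : ℂ} (hq : ‖q‖ < 1) {k : ℕ} (hk : k ≠ 0) : ‖q ^ k‖ < 1 := by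
  rw [norm_pow]; exact pow_lt_one₀ (norm_nonneg q) hq hk

theorem qPochhammerInf_mul_neg (a : ℂ) {q : ℂ} (hq : ‖q‖ < 1) :
    qPochhammerInf a q * qPochhammerInf (-a) q = qPochhammerInf (a ^ 2) (q ^ 2) := by
  rw [qPochhammerInf, qPochhammerInf, ← (multipliable_qPochhammerInf a q hq).tprod_mul
    (multipliable_qPochhammerInf (-a) q hq)]
  exact tprod_congr fun n => by ring

theorem E_mul_neg {q : ℂ} (hq : ‖q‖ < 1) : E q * qPochhammerInf (-q) q = E (q ^ 2) :=
  qPochhammerInf_mul_neg q hq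

theorem E_pow_mul_neg {q : ℂ} (hq : ‖q‖ < 1) {k : ℕ} (hk : k ≠ 0) :
    E (q ^ k) * qPochhammerInf (-q ^ k) (q ^ k) = E (q ^ (2 * k)) := by
  rw [E_mul_neg (norm_pow_lt_one hq hk), ← pow_mul, mul_comm 2 k]

theorem thetaJ_shift {Q z : ℂ} (hQ0 : Q ≠ 0) (hz : z ≠ 0) :
    thetaJ Q z = -z * thetaJ Q (z * Q) := by
  rw [thetaJ, thetaJ, ← (Equiv.addRight (1 : ℤ)).tsum_eq, ← tsum_mul_left]
  refine tsum_congr fun n => ?_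
  rw [Equiv.coe_addRight, tri_succ, zpow_add₀ hQ0, zpow_add_one₀ (neg_ne_zero.2 hz), ← neg_mul,
    mul_zpow]
  ring

/-- One term moves from each Lambert sum to the other, and z/(1-z) + 1/(z-1) = -1. This -1 is the
source of the constant 1 in the series for P. -/
theorem rho_shift {Q z : ℂ} (hQ : ‖Q‖ < 1) (hz : z ≠ 0) (hz1 : z ≠ 1) (hQ0 : Q ≠ 0) :
    rho Q z = rho Q (z * Q) - 1 := by
  have h1 : ∑' n : ℕ, z * Q ^ n / (1 - z * Q ^ n)
      = z / (1 - z) + ∑' n : ℕ, z * Q * Q ^ n / (1 - z * Q * Q ^ n) := by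
    rw [(summable_lambert z z hQ).tsum_eq_zero_add]
    simp only [pow_zero, mul_one, pow_succ', ← mul_assoc]
  have h2 : ∑' n : ℕ, Q / (z * Q) * Q ^ n / (1 - Q / (z * Q) * Q ^ n)
      = 1 / z / (1 - 1 / z) + ∑' n : ℕ, Q / z * Q ^ n / (1 - Q / z * Q ^ n) := by
    rw [show Q / (z * Q) = 1 / z by field_simp, (summable_lambert (1 / z) (1 / z) hQ).tsum_eq_zero_add]
    simp only [pow_zero, mul_one, pow_succ', ← mul_assoc]
    congr 1
    exact tsum_congr fun n => by rw [show 1 / z * Q = Q / z by ring]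
  have h3 : (1 : ℂ) - z ≠ 0 := sub_ne_zero.2 (Ne.symm hz1)
  have h4 : z - 1 ≠ 0 := sub_ne_zero.2 hz1
  have h5 : 1 / z / (1 - 1 / z) = 1 / (z - 1) := by field_simp
  have h6 : z / (1 - z) + 1 / (z - 1) = -1 := by
    rw [show z - 1 = -(1 - z) by ring]; field_simp; ring
  rw [rho, rho, h1, h2, h5]
  linear_combination h6

theorem zpow_ne_one {q : ℂ} (hq0 : q ≠ 0) (hq : ‖q‖ < 1) {n : ℤ} (hn : n ≠ 0) : q ^ n ≠ 1 := by
  intro h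
  have h0 : 0 < ‖q‖ := norm_pos_iff.2 hq0
  have h1 : ‖q‖ ^ n = 1 := by rw [← norm_zpow, h, norm_one]
  exact hn ((zpow_eq_one_iff_right₀ h0.le hq.ne).1 h1)

/-- Raising ζ q^n = 1 to the sixth power removes ζ and leaves a nonzero power of q equal to 1. -/
theorem one_sub_root_mul_zpow_ne_zero {q ζ : ℂ} (hq0 : q ≠ 0) (hq : ‖q‖ < 1) (hζ : ζ ^ 6 = 1)
    {n : ℤ} (hn : n ≠ 0) : 1 - ζ * q ^ n ≠ 0 := by
  intro h
  refine zpow_ne_one hq0 hq (n := n * (6 : ℕ)) (by omega) ?_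
  rw [zpow_mul, zpow_natCast]
  calc (q ^ n) ^ 6 = ζ ^ 6 * (q ^ n) ^ 6 := by rw [hζ, one_mul]
    _ = (ζ * q ^ n) ^ 6 := by ring
    _ = 1 := by rw [← sub_eq_zero.1 h, one_pow]

theorem nonZero_root_mul_zpow {q ζ : ℂ} (hq0 : q ≠ 0) (hq : ‖q‖ < 1) (hζ : ζ ^ 6 = 1) {k : ℕ}
    {a : ℤ} (ha : ¬ (k : ℤ) ∣ a) : NonZero (q ^ k) (ζ * q ^ a) := by
  have hζ0 : ζ ≠ 0 := fun h => by simp [h] at hζ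
  refine ⟨mul_ne_zero hζ0 (zpow_ne_zero _ hq0), fun n => ?_, fun n => ?_⟩
  · have : ζ * q ^ a * (q ^ k) ^ n = ζ * q ^ (a + k * n) := by
      rw [zpow_add₀ hq0, zpow_mul, zpow_natCast, zpow_natCast, mul_assoc]
    rw [this]
    refine one_sub_root_mul_zpow_ne_zero hq0 hq hζ fun h => ha ⟨-n, ?_⟩
    linear_combination h
  · have : q ^ k / (ζ * q ^ a) * (q ^ k) ^ n = ζ⁻¹ * q ^ (k * (n + 1) - a : ℤ) := by
      rw [zpow_sub₀ hq0, zpow_mul, zpow_natCast, zpow_add_one₀ (pow_ne_zero _ hq0), zpow_natCast]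
      field_simp
    rw [this]
    refine one_sub_root_mul_zpow_ne_zero hq0 hq (by rw [inv_pow, hζ, inv_one]) fun h => ha ⟨n + 1, ?_⟩
    linear_combination -h

/-- The symbol (n / b) is multiplicative in n, so agreement at 2 together with reciprocity for odd m
is enough. -/
theorem kroneckerSym_eq {a : ℤ} {b n : ℕ} (hn : n ≠ 0) (hb : ZMod.χ₈ (a : ZMod 8) = jacobiSym 2 b)
    (h : ∀ m : ℕ, Odd m → jacobiSym a m = jacobiSym m b) :
    kroneckerSym a n = jacobiSym n b := by
  have h2 : 2 ^ padicValNat 2 n ∣ n := pow_padicValNat_dvd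
  have hodd : Odd (n / 2 ^ padicValNat 2 n) := by
    rw [← Nat.not_even_iff_odd, even_iff_two_dvd]
    intro h3
    exact pow_succ_padicValNat_not_dvd (p := 2) hn
      (by rw [pow_succ]; exact Nat.mul_dvd_of_dvd_div h2 h3)
  rw [kroneckerSym, if_neg hn, h _ hodd, hb, ← jacobiSym.pow_left, ← jacobiSym.mul_left]
  congr 1
  conv_rhs => rw [← Nat.mul_div_cancel' h2]
  push_cast
  rfl

theorem jacobiSym_five (m : ℕ) (hm : Odd m) : jacobiSym 5 m = jacobiSym m 5 :=
  jacobiSym.quadratic_reciprocity_one_mod_four (a := 5) (by norm_num) hm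

theorem jacobiSym_neg_fifteen (m : ℕ) (hm : Odd m) : jacobiSym (-15) m = jacobiSym m 15 := by
  rw [show (-15 : ℤ) = -((15 : ℕ) : ℤ) by norm_num, jacobiSym.neg _ hm]
  rcases Nat.odd_mod_four_iff.1 (Nat.odd_iff.1 hm) with h | h
  · rw [ZMod.χ₄_nat_one_mod_four h, one_mul,
      jacobiSym.quadratic_reciprocity_one_mod_four' (by decide) h]
  · rw [ZMod.χ₄_nat_three_mod_four h,
      jacobiSym.quadratic_reciprocity_three_mod_four (by norm_num) h]
    simp

theorem kroneckerSym_five {n : ℕ} (hn : n ≠ 0) : kroneckerSym 5 n = jacobiSym n 5 :=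
  kroneckerSym_eq hn (by rw [show jacobiSym 2 (5 : ℕ) = -1 by norm_num]; decide) jacobiSym_five

theorem kroneckerSym_neg_fifteen {n : ℕ} (hn : n ≠ 0) :
    kroneckerSym (-15) n = jacobiSym n 15 :=
  kroneckerSym_eq hn (by rw [show jacobiSym 2 (15 : ℕ) = 1 by norm_num]; decide)
    jacobiSym_neg_fifteen

theorem norm_jacobiSym_le (a : ℤ) (b : ℕ) : ‖(jacobiSym a b : ℂ)‖ ≤ 1 := by
  rcases jacobiSym.trichotomy a b with h | h | h <;> simp [h]

end RamanujanLambert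

/-! ### The Lambert series for P -/

namespace RamanujanLambert

open Filter Topology

theorem thetaJ_root_mul_pow {q ζ : ℂ} (hq0 : q ≠ 0) (hq : ‖q‖ < 1) (hζ : ζ ≠ 0) {a b k : ℕ}
    (hk : a + b = k) (hk0 : k ≠ 0) :
    thetaJ (q ^ k) (ζ * q ^ a)
      = E (q ^ k) * (qPochhammerInf (ζ * q ^ a) (q ^ k) * qPochhammerInf (ζ⁻¹ * q ^ b) (q ^ k)) := by
  rw [thetaJ_eq (pow_ne_zero _ hq0) (norm_pow_lt_one hq hk0) (mul_ne_zero hζ (pow_ne_zero _ hq0))]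
  congr 3
  rw [← hk, pow_add]
  field_simp

/-- One residue class of a Lambert series. -/
noncomputable def lambertClass (q ζ : ℂ) (k a : ℕ) : ℂ :=
  ∑' n : ℕ, ζ * q ^ (a + k * n) / (1 - ζ * q ^ (a + k * n))

theorem rho_root_mul_pow {q ζ : ℂ} (hq0 : q ≠ 0) (hζ : ζ ≠ 0) {a b k : ℕ} (hk : a + b = k) :
    rho (q ^ k) (ζ * q ^ a) = lambertClass q ζ k a - lambertClass q ζ⁻¹ k b := by
  rw [rho, lambertClass, lambertClass]
  have e : q ^ k / (ζ * q ^ a) = ζ⁻¹ * q ^ b := by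
    rw [← hk, pow_add]; field_simp
  simp only [e, pow_add, pow_mul, mul_assoc]

theorem summable_termP {q : ℂ} (hq : ‖q‖ < 1) : Summable fun n : ℕ+ => termP q n := by
  have h : Summable fun n : ℕ => ‖1 * q ^ n / (1 - -1 * q ^ n)‖ := summable_norm_lambert (-1) 1 hq
  refine Summable.of_norm_bounded (h.comp_injective PNat.coe_injective) fun n => ?_
  rw [termP, kroneckerSym_neg_fifteen n.ne_zero, norm_mul]
  refine (mul_le_of_le_one_left (norm_nonneg _) (norm_jacobiSym_le _ _)).trans (le_of_eq ?_)
  simp [Function.comp]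

theorem summable_termQ {q : ℂ} (hq : ‖q‖ < 1) : Summable fun n : ℕ+ => termQ q n := by
  have h0 := summable_geometric_of_lt_one (norm_nonneg q) hq
  have h : Summable fun n : ℕ => ‖q ^ n * (1 + q ^ n) / (1 + q ^ (3 * n))‖ := by
    refine Summable.of_norm_bounded_eventually_nat (g := fun n : ℕ => 4 * ‖q‖ ^ n)
      (h0.mul_left _) ?_
    filter_upwards [one_sub_mul_pow_eventually (-1) (norm_pow_lt_one hq three_ne_zero)] with n hn
    have e : 1 + q ^ (3 * n) = 1 - -1 * (q ^ 3) ^ n := by rw [← pow_mul]; ring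
    rw [norm_norm, e, norm_div, norm_mul, norm_pow, div_le_iff₀ (by linarith)]
    have h1 : ‖1 + q ^ n‖ ≤ 2 := by
      refine (norm_add_le _ _).trans ?_
      have := pow_le_one₀ (n := n) (norm_nonneg q) hq.le
      rw [norm_one, norm_pow]; linarith
    have h2 : 0 ≤ ‖q‖ ^ n := by positivity
    nlinarith
  refine Summable.of_norm_bounded (h.comp_injective PNat.coe_injective) fun n => ?_
  rw [termQ, kroneckerSym_five n.ne_zero, norm_mul]
  exact mul_le_of_le_one_left (norm_nonneg _) (norm_jacobiSym_le _ _)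

theorem tsum_pnat_eq_tsum_nat {f : ℕ → ℂ} (h0 : f 0 = 0) :
    ∑' n : ℕ+, f n = ∑' n : ℕ, f n := by
  refine PNat.coe_injective.tsum_eq fun n hn => ?_
  have : n ≠ 0 := by rintro rfl; exact hn h0
  exact ⟨⟨n, Nat.pos_of_ne_zero this⟩, rfl⟩

theorem summable_nat_of_pnat {f : ℕ → ℂ} (h0 : f 0 = 0) (h : Summable fun n : ℕ+ => f n) :
    Summable f := by
  refine (PNat.coe_injective.summable_iff fun n hn => ?_).1 h
  by_contra h1
  have : n ≠ 0 := by rintro rfl; exact h1 h0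
  exact hn ⟨⟨n, Nat.pos_of_ne_zero this⟩, rfl⟩

theorem termP_zero (q : ℂ) : termP q 0 = 0 := by simp [termP, kroneckerSym]

theorem termQ_zero (q : ℂ) : termQ q 0 = 0 := by simp [termQ, kroneckerSym]

theorem tsum_termP_class (q : ℂ) {a : ℕ} (ha : a ≠ 0) :
    ∑' m : ℕ, termP q (a + 15 * m) = -(jacobiSym a 15 : ℂ) * lambertClass q (-1) 15 a := by
  rw [lambertClass, ← tsum_mul_left]
  refine tsum_congr fun m => ?_
  have h : jacobiSym ((a + 15 * m : ℕ) : ℤ) 15 = jacobiSym a 15 := by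
    exact jacobiSym.mod_left' (by push_cast; exact Int.add_mul_emod_self_left _ _ _)
  rw [termP, kroneckerSym_neg_fifteen (by omega), h]
  rw [show 1 + q ^ (a + 15 * m) = 1 - -1 * q ^ (a + 15 * m) by ring]
  ring

theorem tsum_termP_class_zero (q : ℂ) : ∑' m : ℕ, termP q (0 + 15 * m) = 0 := by
  rw [← tsum_zero (α := ℂ) (β := ℕ)]
  refine tsum_congr fun m => ?_
  rcases eq_or_ne m 0 with rfl | hm
  · exact termP_zero q
  · have h : jacobiSym ((0 + 15 * m : ℕ) : ℤ) 15 = 0 := by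
      rw [jacobiSym.mod_left]; push_cast; rw [Int.add_mul_emod_self_left]; norm_num
    rw [termP, kroneckerSym_neg_fifteen (by omega), h]
    simp

theorem tsum_termP_eq {q : ℂ} (hq : ‖q‖ < 1) :
    ∑' n : ℕ+, termP q n = -(lambertClass q (-1) 15 1 + lambertClass q (-1) 15 2
      + lambertClass q (-1) 15 4 + lambertClass q (-1) 15 8 - lambertClass q (-1) 15 7
      - lambertClass q (-1) 15 11 - lambertClass q (-1) 15 13 - lambertClass q (-1) 15 14) := by
  rw [tsum_pnat_eq_tsum_nat (termP_zero q), Nat.sumByResidueClasses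
    (summable_nat_of_pnat (termP_zero q) (summable_termP hq)) 15]
  change ∑ j : Fin 15, ∑' m, termP q ((j : ℕ) + 15 * m) = _
  rw [Fin.sum_univ_eq_sum_range (fun j => ∑' m, termP q (j + 15 * m)), Finset.sum_range_succ',
    tsum_termP_class_zero, add_zero, Finset.sum_congr rfl fun j _ => tsum_termP_class q j.succ_ne_zero]
  have j1 : jacobiSym (1 : ℕ) 15 = 1 := by norm_num
  have j2 : jacobiSym (2 : ℕ) 15 = 1 := by norm_num
  have j3 : jacobiSym (3 : ℕ) 15 = 0 := by norm_num
  have j4 : jacobiSym (4 : ℕ) 15 = 1 := by norm_num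
  have j5 : jacobiSym (5 : ℕ) 15 = 0 := by norm_num
  have j6 : jacobiSym (6 : ℕ) 15 = 0 := by norm_num
  have j7 : jacobiSym (7 : ℕ) 15 = -1 := by norm_num
  have j8 : jacobiSym (8 : ℕ) 15 = 1 := by norm_num
  have j9 : jacobiSym (9 : ℕ) 15 = 0 := by norm_num
  have j10 : jacobiSym (10 : ℕ) 15 = 0 := by norm_num
  have j11 : jacobiSym (11 : ℕ) 15 = -1 := by norm_num
  have j12 : jacobiSym (12 : ℕ) 15 = 0 := by norm_num
  have j13 : jacobiSym (13 : ℕ) 15 = -1 := by norm_num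
  have j14 : jacobiSym (14 : ℕ) 15 = -1 := by norm_num
  simp only [Finset.sum_range_succ, Finset.sum_range_zero, zero_add, Nat.reduceAdd, j1, j2, j3, j4,
    j5, j6, j7, j8, j9, j10, j11, j12, j13, j14]
  push_cast
  ring

/-- Each ρ(-q^a) is the class of a minus the class of 15 - a. The classes 1, 2, 4, 8 receive one
sign and 7, 11, 13, 14 the other, as the character modulo 15 requires; shifting -q⁻¹ to -q^14 adds
the 1. -/
theorem rho_sum_neg_one {q : ℂ} (hq0 : q ≠ 0) (hq : ‖q‖ < 1) :
    rho (q ^ 15) (-q ^ 2) + rho (q ^ 15) (-q ^ 4) - rho (q ^ 15) (-q⁻¹) - rho (q ^ 15) (-q ^ 7)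
      = 1 - ∑' n : ℕ+, termP q n := by
  have h : ∀ {a b : ℕ}, a + b = 15 → rho (q ^ 15) (-q ^ a)
      = lambertClass q (-1) 15 a - lambertClass q (-1) 15 b := by
    intro a b hab
    have := rho_root_mul_pow hq0 (ζ := -1) (by norm_num) hab
    rwa [neg_one_mul, inv_neg, inv_one] at this
  have h1 : rho (q ^ 15) (-q⁻¹) = rho (q ^ 15) (-q ^ 14) - 1 := by
    rw [rho_shift (norm_pow_lt_one hq (by norm_num)) (neg_ne_zero.2 (inv_ne_zero hq0)) ?_
      (pow_ne_zero _ hq0)]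
    · congr 2; field_simp
    · intro h
      have := one_sub_root_mul_zpow_ne_zero hq0 hq (ζ := -1) (n := -1) (by norm_num) (by norm_num)
      rw [zpow_neg_one, neg_one_mul, h] at this
      exact this (sub_self 1)
  rw [h1, h (show 2 + 13 = 15 by norm_num), h (show 4 + 11 = 15 by norm_num),
    h (show 14 + 1 = 15 by norm_num), h (show 7 + 8 = 15 by norm_num), tsum_termP_eq hq]
  ring

theorem theta_sum_neg_one {q : ℂ} (hq0 : q ≠ 0) (hq : ‖q‖ < 1) :
    (1 - ∑' n : ℕ+, termP q n) * (thetaJ (q ^ 15) (-q ^ 2) * thetaJ (q ^ 15) (-q ^ 4)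
        * (thetaJ (q ^ 15) (-q ^ 14) * thetaJ (q ^ 15) (-q ^ 7)))
      = E (q ^ 15) ^ 3 * (thetaJ (q ^ 15) (q ^ 6) * thetaJ (q ^ 15) (q ^ 10)
        * thetaJ (q ^ 15) (q ^ 3)) := by
  have hQ0 : q ^ 15 ≠ 0 := pow_ne_zero _ hq0
  have hQ : ‖q ^ 15‖ < 1 := norm_pow_lt_one hq (by norm_num)
  have nz : ∀ {a : ℤ}, ¬ ((15 : ℕ) : ℤ) ∣ a → NonZero (q ^ 15) (-1 * q ^ a) :=
    nonZero_root_mul_zpow hq0 hq (by norm_num)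
  have e1 : q ^ 3 * -q⁻¹ = -q ^ 2 := by field_simp
  have e2 : q ^ 3 / -q⁻¹ = -q ^ 4 := by field_simp
  have e3 : q ^ 3 * -(q ^ 4)⁻¹ = -q⁻¹ := by field_simp
  have e4 : q ^ 3 / -(q ^ 4)⁻¹ = -q ^ 7 := by field_simp
  have e5 : q ^ 3 * q ^ 3 = q ^ 6 := by ring
  have e6 : -q⁻¹ * -(q ^ 4)⁻¹ = (q ^ 5)⁻¹ := by field_simp
  have e7 : -q⁻¹ / -(q ^ 4)⁻¹ = q ^ 3 := by field_simp
  have z0 : NonZero (q ^ 15) (q ^ 3 * q ^ 3) := by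
    have := nonZero_root_mul_zpow hq0 hq (ζ := 1) (one_pow 6) (k := 15) (a := 6) (by decide)
    rw [one_mul] at this
    rw [e5]
    exact_mod_cast this
  have z1 : NonZero (q ^ 15) (q ^ 3 * -q⁻¹) := by
    rw [e1, ← neg_one_mul]; exact_mod_cast nz (a := 2) (by decide)
  have z2 : NonZero (q ^ 15) (q ^ 3 / -q⁻¹) := by
    rw [e2, ← neg_one_mul]; exact_mod_cast nz (a := 4) (by decide)
  have z3 : NonZero (q ^ 15) (q ^ 3 * -(q ^ 4)⁻¹) := by
    rw [e3, ← neg_one_mul, ← zpow_neg_one]; exact nz (a := -1) (by decide)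
  have z4 : NonZero (q ^ 15) (q ^ 3 / -(q ^ 4)⁻¹) := by
    rw [e4, ← neg_one_mul]; exact_mod_cast nz (a := 7) (by decide)
  -- The choice x = q³, y = -q⁻¹, v = -q⁻⁴ makes xy, x/y, xv, x/v equal to -q², -q⁴, -q⁻¹, -q⁷,
  -- while x², yv, y/v are free of signs.
  have key := rho_four_term hQ0 hQ (pow_ne_zero 3 hq0) (neg_ne_zero.2 (inv_ne_zero hq0))
    (neg_ne_zero.2 (inv_ne_zero (pow_ne_zero 4 hq0))) z0 z1 z2 z3 z4
  have t1 : thetaJ (q ^ 15) (q ^ 5)⁻¹ = -(q ^ 5)⁻¹ * thetaJ (q ^ 15) (q ^ 10) := by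
    rw [thetaJ_shift hQ0 (inv_ne_zero (pow_ne_zero 5 hq0))]
    congr 2
    field_simp
  have t2 : thetaJ (q ^ 15) (-q⁻¹) = q⁻¹ * thetaJ (q ^ 15) (-q ^ 14) := by
    rw [thetaJ_shift hQ0 (neg_ne_zero.2 (inv_ne_zero hq0)), neg_neg]
    congr 2
    field_simp
  rw [e1, e2, e3, e4, e5, e6, e7, rho_sum_neg_one hq0 hq, t1, t2] at key
  have hq5 : q ^ 5 ≠ 0 := pow_ne_zero 5 hq0
  field_simp at key
  linear_combination -key

theorem qPochhammerInf_mul_range_eq (ζ : ℂ) {q : ℂ} (hq : ‖q‖ < 1) {d k : ℕ} (hd : d ≠ 0)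
    (hk : k ≠ 0) : qPochhammerInf (ζ * q ^ d) (q ^ d)
      = ∏ i ∈ Finset.range k, qPochhammerInf (ζ * q ^ (d * (i + 1))) (q ^ (d * k)) := by
  rw [qPochhammerInf_eq_prod _ (norm_pow_lt_one hq hd) hk]
  refine Finset.prod_congr rfl fun i _ => ?_
  rw [← pow_mul, ← pow_mul, mul_add, mul_one, pow_add]
  congr 1
  ring

theorem P_eq_of_ne_zero {q : ℂ} (hq0 : q ≠ 0) (hq : ‖q‖ < 1) :
    P q = 1 - ∑' n : ℕ+, termP q n := by
  have key := theta_sum_neg_one hq0 hq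
  have tp : ∀ {a b : ℕ}, a + b = 15 → thetaJ (q ^ 15) (q ^ a) = E (q ^ 15) *
      (qPochhammerInf (q ^ a) (q ^ 15) * qPochhammerInf (q ^ b) (q ^ 15)) := by
    intro a b h
    have := thetaJ_root_mul_pow hq0 hq one_ne_zero h (by norm_num)
    rwa [inv_one, one_mul, one_mul] at this
  have tm : ∀ {a b : ℕ}, a + b = 15 → thetaJ (q ^ 15) (-q ^ a) = E (q ^ 15) *
      (qPochhammerInf (-q ^ a) (q ^ 15) * qPochhammerInf (-q ^ b) (q ^ 15)) := by
    intro a b h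
    have := thetaJ_root_mul_pow hq0 hq (neg_ne_zero.2 one_ne_zero) h (by norm_num)
    rwa [inv_neg, inv_one, neg_one_mul, neg_one_mul] at this
  rw [tm (show 2 + 13 = 15 by norm_num), tm (show 4 + 11 = 15 by norm_num),
    tm (show 14 + 1 = 15 by norm_num), tm (show 7 + 8 = 15 by norm_num),
    tp (show 6 + 9 = 15 by norm_num), tp (show 10 + 5 = 15 by norm_num),
    tp (show 3 + 12 = 15 by norm_num)] at key
  have e3 := qPochhammerInf_mul_range_eq 1 hq three_ne_zero (k := 5) (by norm_num)
  have e5 := qPochhammerInf_mul_range_eq 1 hq (d := 5) (by norm_num) three_ne_zero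
  have n1 := qPochhammerInf_mul_range_eq (-1) hq one_ne_zero (k := 15) (by norm_num)
  have n3 := qPochhammerInf_mul_range_eq (-1) hq three_ne_zero (k := 5) (by norm_num)
  have n5 := qPochhammerInf_mul_range_eq (-1) hq (d := 5) (by norm_num) three_ne_zero
  simp only [Finset.prod_range_succ, Finset.prod_range_zero, one_mul, Nat.reduceAdd, Nat.reduceMul,
    neg_one_mul, pow_one, zero_add] at e3 e5 n1 n3 n5
  change E (q ^ 3) = _ at e3
  change E (q ^ 5) = _ at e5
  have m1 := E_pow_mul_neg hq one_ne_zero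
  have m3 := E_pow_mul_neg hq three_ne_zero
  have m5 := E_pow_mul_neg hq (k := 5) (by norm_num)
  have m15 := E_pow_mul_neg hq (k := 15) (by norm_num)
  norm_num at m1 m3 m5 m15
  have hE : ∀ {k : ℕ}, k ≠ 0 → E (q ^ k) ≠ 0 := fun hk => E_ne_zero _ (norm_pow_lt_one hq hk)
  have h15 : E (q ^ 15) ^ 4 ≠ 0 := pow_ne_zero 4 (hE (by norm_num))
  rw [show qPochhammerInf (q ^ 15) (q ^ 15) = E (q ^ 15) from rfl] at e3 e5
  -- The left product runs over the residues prime to 15; the multiples of 3 and of 5 on the right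
  -- of `key` assemble into E(q³) E(q⁵).
  have hA : (1 - ∑' n : ℕ+, termP q n) * (qPochhammerInf (-q) (q ^ 15) *
      qPochhammerInf (-q ^ 2) (q ^ 15) * qPochhammerInf (-q ^ 4) (q ^ 15) *
      qPochhammerInf (-q ^ 7) (q ^ 15) * qPochhammerInf (-q ^ 8) (q ^ 15) *
      qPochhammerInf (-q ^ 11) (q ^ 15) * qPochhammerInf (-q ^ 13) (q ^ 15) *
      qPochhammerInf (-q ^ 14) (q ^ 15)) = E (q ^ 3) * E (q ^ 5) := by
    refine mul_left_cancel₀ h15 ?_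
    rw [e3, e5]
    simp only [pow_one] at key
    linear_combination key
  rw [P, div_eq_iff (mul_ne_zero (hE two_ne_zero) (hE (by norm_num))), ← m1, ← m3, ← m5, ← m15,
    n1, n3, n5]
  linear_combination (-E q * E (q ^ 15) * qPochhammerInf (-q ^ 3) (q ^ 15) *
    qPochhammerInf (-q ^ 6) (q ^ 15) * qPochhammerInf (-q ^ 9) (q ^ 15) *
    qPochhammerInf (-q ^ 12) (q ^ 15) * qPochhammerInf (-q ^ 15) (q ^ 15) ^ 2 *
    qPochhammerInf (-q ^ 5) (q ^ 15) * qPochhammerInf (-q ^ 10) (q ^ 15)) * hA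

end RamanujanLambert

/-! ### The Lambert series for Q, by means of a primitive sixth root of unity -/

namespace RamanujanLambert

open Filter Topology

theorem exists_sixth_root : ∃ w : ℂ, w ^ 2 = w - 1 := by
  obtain ⟨z, hz⟩ := IsAlgClosed.exists_pow_nat_eq (-3 : ℂ) two_pos
  exact ⟨(1 + z) / 2, by linear_combination hz / 4⟩

variable {w : ℂ}

theorem sixth_root_ne_zero (hw : w ^ 2 = w - 1) : w ≠ 0 := by
  rintro rfl
  norm_num at hw

theorem sixth_root_inv (hw : w ^ 2 = w - 1) : w⁻¹ = 1 - w :=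
  inv_eq_of_mul_eq_one_right (by linear_combination -hw)

theorem sixth_root_pow_six (hw : w ^ 2 = w - 1) : w ^ 6 = 1 := by
  linear_combination (w ^ 4 + w ^ 3 - w - 1) * hw

theorem sixth_root_sub_inv_ne_zero (hw : w ^ 2 = w - 1) : w - w⁻¹ ≠ 0 := by
  rw [sixth_root_inv hw]
  intro h
  have : (3 : ℂ) = 0 := by linear_combination 4 * hw - (w - (1 - w)) * h
  norm_num at this

theorem one_sub_root_mul_pow_ne_zero {q ζ : ℂ} (hq : ‖q‖ < 1) (hζ : ζ ^ 6 = 1) {n : ℕ}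
    (hn : n ≠ 0) : 1 - ζ * q ^ n ≠ 0 := by
  rcases eq_or_ne q 0 with rfl | hq0
  · simp [hn]
  · exact_mod_cast one_sub_root_mul_zpow_ne_zero hq0 hq hζ (n := n) (by exact_mod_cast hn)

theorem summable_lambertClass {q : ℂ} (ζ : ℂ) (hq : ‖q‖ < 1) {k : ℕ} (hk : k ≠ 0) (a : ℕ) :
    Summable fun n : ℕ => ζ * q ^ (a + k * n) / (1 - ζ * q ^ (a + k * n)) := by
  refine (summable_lambert (ζ * q ^ a) (ζ * q ^ a) (norm_pow_lt_one hq hk)).congr fun n => ?_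
  rw [pow_add, pow_mul, mul_assoc]

/-- With X = q^n, (1 - wX)(1 - w⁻¹X) = 1 - X + X², and multiplying by 1 + X gives 1 + X³. -/
theorem lambert_sub_inv (hw : w ^ 2 = w - 1) {q : ℂ} (hq : ‖q‖ < 1) {n : ℕ} (hn : n ≠ 0) :
    w * q ^ n / (1 - w * q ^ n) - w⁻¹ * q ^ n / (1 - w⁻¹ * q ^ n)
      = (w - w⁻¹) * (q ^ n * (1 + q ^ n) / (1 + q ^ (3 * n))) := by
  have h1 := one_sub_root_mul_pow_ne_zero hq (sixth_root_pow_six hw) hn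
  have h2 := one_sub_root_mul_pow_ne_zero hq (ζ := w⁻¹)
    (by rw [inv_pow, sixth_root_pow_six hw, inv_one]) hn
  have h3 := one_sub_root_mul_pow_ne_zero hq (ζ := -1) (by norm_num) hn
  rw [sixth_root_inv hw] at h2 ⊢
  have e : 1 + q ^ (3 * n) = (1 - w * q ^ n) * (1 - (1 - w) * q ^ n) * (1 - -1 * q ^ n) := by
    rw [mul_comm 3 n, pow_mul]
    linear_combination ((q ^ n) ^ 2 + (q ^ n) ^ 3) * hw
  rw [e, div_sub_div _ _ h1 h2, mul_div_assoc', div_eq_div_iff (mul_ne_zero h1 h2)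
    (mul_ne_zero (mul_ne_zero h1 h2) h3)]
  ring

theorem tsum_termQ_class (hw : w ^ 2 = w - 1) {q : ℂ} (hq : ‖q‖ < 1) {a : ℕ} (ha : a ≠ 0) :
    (w - w⁻¹) * ∑' m : ℕ, termQ q (a + 5 * m)
      = (jacobiSym a 5 : ℂ) * (lambertClass q w 5 a - lambertClass q w⁻¹ 5 a) := by
  rw [lambertClass, lambertClass, ← (summable_lambertClass w hq (by norm_num) a).tsum_sub
    (summable_lambertClass w⁻¹ hq (by norm_num) a), ← tsum_mul_left, ← tsum_mul_left]
  refine tsum_congr fun m => ?_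
  have h : jacobiSym ((a + 5 * m : ℕ) : ℤ) 5 = jacobiSym a 5 := by
    exact jacobiSym.mod_left' (by push_cast; exact Int.add_mul_emod_self_left _ _ _)
  rw [lambert_sub_inv hw hq (by omega), termQ, kroneckerSym_five (by omega), h]
  ring

theorem tsum_termQ_class_zero (q : ℂ) : ∑' m : ℕ, termQ q (0 + 5 * m) = 0 := by
  rw [← tsum_zero (α := ℂ) (β := ℕ)]
  refine tsum_congr fun m => ?_
  rcases eq_or_ne m 0 with rfl | hm
  · exact termQ_zero q
  · have h : jacobiSym ((0 + 5 * m : ℕ) : ℤ) 5 = 0 := by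
      rw [jacobiSym.mod_left]; push_cast; rw [Int.add_mul_emod_self_left]; norm_num
    rw [termQ, kroneckerSym_five (by omega), h]
    simp

theorem tsum_termQ_eq (hw : w ^ 2 = w - 1) {q : ℂ} (hq : ‖q‖ < 1) :
    (w - w⁻¹) * ∑' n : ℕ+, termQ q n = lambertClass q w 5 1 - lambertClass q w⁻¹ 5 1
      - (lambertClass q w 5 2 - lambertClass q w⁻¹ 5 2)
      - (lambertClass q w 5 3 - lambertClass q w⁻¹ 5 3)
      + (lambertClass q w 5 4 - lambertClass q w⁻¹ 5 4) := by
  rw [tsum_pnat_eq_tsum_nat (termQ_zero q), Nat.sumByResidueClasses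
    (summable_nat_of_pnat (termQ_zero q) (summable_termQ hq)) 5]
  change _ * ∑ j : Fin 5, ∑' m, termQ q ((j : ℕ) + 5 * m) = _
  rw [Fin.sum_univ_eq_sum_range (fun j => ∑' m, termQ q (j + 5 * m)), Finset.sum_range_succ',
    tsum_termQ_class_zero, add_zero, Finset.mul_sum,
    Finset.sum_congr rfl fun j _ => tsum_termQ_class hw hq j.succ_ne_zero]
  have j1 : jacobiSym (1 : ℕ) 5 = 1 := by norm_num
  have j2 : jacobiSym (2 : ℕ) 5 = -1 := by norm_num
  have j3 : jacobiSym (3 : ℕ) 5 = -1 := by norm_num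
  have j4 : jacobiSym (4 : ℕ) 5 = 1 := by norm_num
  simp only [Finset.sum_range_succ, Finset.sum_range_zero, zero_add, Nat.reduceAdd, j1, j2, j3, j4]
  push_cast
  ring

theorem rho_sum_sixth_root (hw : w ^ 2 = w - 1) {q : ℂ} (hq0 : q ≠ 0) (hq : ‖q‖ < 1) :
    rho (q ^ 5) (w * q) + rho (q ^ 5) (w / q) - rho (q ^ 5) (w * q ^ 2) - rho (q ^ 5) (w / q ^ 2)
      = (w - w⁻¹) * ∑' n : ℕ+, termQ q n := by
  have hw0 := sixth_root_ne_zero hw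
  have h : ∀ {a b : ℕ}, a + b = 5 → rho (q ^ 5) (w * q ^ a)
      = lambertClass q w 5 a - lambertClass q w⁻¹ 5 b := rho_root_mul_pow hq0 hw0
  have hs : ∀ {a b : ℕ}, a + b = 5 → a ≠ 0 → rho (q ^ 5) (w / q ^ a)
      = rho (q ^ 5) (w * q ^ b) - 1 := by
    intro a b hab ha
    have hqa : q ^ a ≠ 0 := pow_ne_zero a hq0
    rw [rho_shift (norm_pow_lt_one hq (by norm_num)) (div_ne_zero hw0 hqa) ?_ (pow_ne_zero _ hq0)]
    · congr 2
      rw [← hab, pow_add]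
      field_simp
    · intro h
      have := one_sub_root_mul_pow_ne_zero hq (ζ := w⁻¹)
        (by rw [inv_pow, sixth_root_pow_six hw, inv_one]) ha
      rw [div_eq_one_iff_eq hqa] at h
      rw [← h, inv_mul_cancel₀ hw0] at this
      exact this (sub_self 1)
  have s1 := hs (show 1 + 4 = 5 by norm_num) one_ne_zero
  have h1 := h (show 1 + 4 = 5 by norm_num)
  rw [pow_one] at s1 h1
  rw [s1, hs (show 2 + 3 = 5 by norm_num) two_ne_zero, h1, h (show 4 + 1 = 5 by norm_num),
    h (show 2 + 3 = 5 by norm_num), h (show 3 + 2 = 5 by norm_num), tsum_termQ_eq hw hq]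
  ring

theorem theta_sum_sixth_root (hw : w ^ 2 = w - 1) {q : ℂ} (hq0 : q ≠ 0) (hq : ‖q‖ < 1) :
    (w - w⁻¹) * (∑' n : ℕ+, termQ q n) * (w * (thetaJ (q ^ 5) (w * q) * thetaJ (q ^ 5) (w * q ^ 2)
        * (thetaJ (q ^ 5) (w * q ^ 3) * thetaJ (q ^ 5) (w * q ^ 4))))
      = -q * E (q ^ 5) ^ 3 * (thetaJ (q ^ 5) (w ^ 2) * thetaJ (q ^ 5) (q ^ 3)
        * thetaJ (q ^ 5) (q ^ 4)) := by
  have hw0 := sixth_root_ne_zero hw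
  have hw6 := sixth_root_pow_six hw
  have hQ0 : q ^ 5 ≠ 0 := pow_ne_zero _ hq0
  have hQ : ‖q ^ 5‖ < 1 := norm_pow_lt_one hq (by norm_num)
  have nz : ∀ {a : ℤ}, ¬ ((5 : ℕ) : ℤ) ∣ a → NonZero (q ^ 5) (w * q ^ a) :=
    nonZero_root_mul_zpow hq0 hq hw6
  have e0 : w * w = w ^ 2 := (sq w).symm
  have e6 : q * q ^ 2 = q ^ 3 := by ring
  have e7 : q / q ^ 2 = q⁻¹ := by field_simp
  have z0 : NonZero (q ^ 5) (w * w) := by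
    have hw2 : (w * w) ^ 6 = 1 := by rw [mul_pow, hw6, one_mul]
    refine ⟨mul_ne_zero hw0 hw0, fun n => ?_, fun n => ?_⟩
    · rcases eq_or_ne n 0 with rfl | hn
      -- For n = 0 the power of q is 1, so w² ≠ 1 itself is needed: with w² = w - 1 it would force w
      -- = 2.
      · intro h
        have h3 : w = 2 := by linear_combination -hw - h
        rw [h3] at hw
        norm_num at hw
      · rw [← pow_mul]
        exact one_sub_root_mul_pow_ne_zero hq hw2 (by omega)
    · have : q ^ 5 / (w * w) * (q ^ 5) ^ n = (w * w)⁻¹ * q ^ (5 * (n + 1)) := by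
        rw [mul_add, pow_add, pow_mul]; field_simp
      rw [this]
      exact one_sub_root_mul_pow_ne_zero hq (by rw [inv_pow, hw2, inv_one]) (by omega)
  have z1 : NonZero (q ^ 5) (w * q) := by simpa using nz (a := 1) (by decide)
  have z2 : NonZero (q ^ 5) (w / q) := by
    have := nz (a := -1) (by decide)
    rwa [zpow_neg_one, ← div_eq_mul_inv] at this
  have z3 : NonZero (q ^ 5) (w * q ^ 2) := by exact_mod_cast nz (a := 2) (by decide)
  have z4 : NonZero (q ^ 5) (w / q ^ 2) := by
    have := nz (a := -2) (by decide)
    rw [zpow_neg, ← div_eq_mul_inv] at this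
    exact_mod_cast this
  -- Here x = w, y = q, v = q². Conjugate roots then occur in pairs, and the constants from shifting
  -- w/q and w/q² cancel.
  have key := rho_four_term hQ0 hQ hw0 hq0 (pow_ne_zero 2 hq0) z0 z1 z2 z3 z4
  have t1 : thetaJ (q ^ 5) q⁻¹ = -q⁻¹ * thetaJ (q ^ 5) (q ^ 4) := by
    rw [thetaJ_shift hQ0 (inv_ne_zero hq0)]
    congr 2
    field_simp
  have t2 : thetaJ (q ^ 5) (w / q) = -(w / q) * thetaJ (q ^ 5) (w * q ^ 4) := by
    rw [thetaJ_shift hQ0 (div_ne_zero hw0 hq0)]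
    congr 2
    field_simp
  have t3 : thetaJ (q ^ 5) (w / q ^ 2) = -(w / q ^ 2) * thetaJ (q ^ 5) (w * q ^ 3) := by
    rw [thetaJ_shift hQ0 (div_ne_zero hw0 (pow_ne_zero 2 hq0))]
    congr 2
    field_simp
  rw [rho_sum_sixth_root hw hq0 hq, e0, e6, e7, t1, t2, t3] at key
  generalize w - w⁻¹ = W at key ⊢
  field_simp at key
  rw [mul_comm w q, mul_comm w (q ^ 2), mul_comm w (q ^ 3), mul_comm w (q ^ 4)]
  linear_combination key

theorem qPochhammerInf_cube {q : ℂ} (a : ℂ) (hw : w ^ 2 = w - 1) (hq : ‖q‖ < 1) :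
    qPochhammerInf (-a) q * qPochhammerInf (w * a) q * qPochhammerInf (w⁻¹ * a) q
      = qPochhammerInf (-a ^ 3) (q ^ 3) := by
  have h1 := multipliable_qPochhammerInf (-a) q hq
  have h2 := multipliable_qPochhammerInf (w * a) q hq
  have h3 := multipliable_qPochhammerInf (w⁻¹ * a) q hq
  simp only [qPochhammerInf]
  rw [← h1.tprod_mul h2, ← (h1.mul h2).tprod_mul h3]
  refine tprod_congr fun n => ?_
  rw [sixth_root_inv hw]
  linear_combination (-(a * q ^ n) ^ 2 - (a * q ^ n) ^ 3) * hw

theorem E_cube {q : ℂ} (hw : w ^ 2 = w - 1) (hq : ‖q‖ < 1) :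
    E (q ^ 3) * (E (q ^ 2) * (qPochhammerInf (w * q) q * qPochhammerInf (w⁻¹ * q) q))
      = E q * E (q ^ 6) := by
  have h1 := E_pow_mul_neg hq three_ne_zero
  norm_num at h1
  rw [← h1, ← E_mul_neg hq, ← qPochhammerInf_cube q hw hq]
  ring

theorem Q_eq_of_ne_zero {q : ℂ} (hq0 : q ≠ 0) (hq : ‖q‖ < 1) :
    Q q = ∑' n : ℕ+, termQ q n := by
  obtain ⟨w, hw⟩ := exists_sixth_root
  have hw0 := sixth_root_ne_zero hw
  have hq5 : ‖q ^ 5‖ < 1 := norm_pow_lt_one hq (by norm_num)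
  have hQ0 : q ^ 5 ≠ 0 := pow_ne_zero _ hq0
  have key := theta_sum_sixth_root hw hq0 hq
  have tp : ∀ {a b : ℕ}, a + b = 5 → thetaJ (q ^ 5) (q ^ a) = E (q ^ 5) *
      (qPochhammerInf (q ^ a) (q ^ 5) * qPochhammerInf (q ^ b) (q ^ 5)) := by
    intro a b h
    have := thetaJ_root_mul_pow hq0 hq one_ne_zero h (by norm_num)
    rwa [inv_one, one_mul, one_mul] at this
  have tw : ∀ {a b : ℕ}, a + b = 5 → thetaJ (q ^ 5) (w * q ^ a) = E (q ^ 5) *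
      (qPochhammerInf (w * q ^ a) (q ^ 5) * qPochhammerInf (w⁻¹ * q ^ b) (q ^ 5)) :=
    fun h => thetaJ_root_mul_pow hq0 hq hw0 h (by norm_num)
  have t1 := tw (show 1 + 4 = 5 by norm_num)
  rw [pow_one] at t1
  -- As w² is a primitive cube root of unity, the triple product is a product over all cube roots of
  -- unity, up to the factor 1 - w².
  have t0 : thetaJ (q ^ 5) (w ^ 2) = (1 - w ^ 2) * E (q ^ 15) := by
    have hw2 : (w ^ 2)⁻¹ = -w := by
      rw [← inv_pow, sixth_root_inv hw]; linear_combination hw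
    have hc := qPochhammerInf_cube (-(q ^ 5)) hw hq5
    have c1 : -(-(q ^ 5)) = q ^ 5 := neg_neg _
    have c2 : w * -(q ^ 5) = q ^ 5 / w ^ 2 := by rw [div_eq_mul_inv, hw2]; ring
    have c3 : w⁻¹ * -(q ^ 5) = w ^ 2 * q ^ 5 := by
      rw [sixth_root_inv hw]; linear_combination (-q ^ 5) * hw
    have c4 : -(-(q ^ 5)) ^ 3 = (q ^ 5) ^ 3 := by ring
    rw [c1, c2, c3, c4, ← pow_mul] at hc
    rw [thetaJ_eq hQ0 hq5 (pow_ne_zero 2 hw0), qPochhammerInf_eq_mul _ hq5]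
    change E (q ^ 5) * _ * _ = E (q ^ 15) at hc
    linear_combination (1 - w ^ 2) * hc
  rw [t1, tw (show 2 + 3 = 5 by norm_num), tw (show 3 + 2 = 5 by norm_num),
    tw (show 4 + 1 = 5 by norm_num), tp (show 3 + 2 = 5 by norm_num),
    tp (show 4 + 1 = 5 by norm_num), t0] at key
  have e1 := qPochhammerInf_mul_range_eq 1 hq one_ne_zero (k := 5) (by norm_num)
  have w1 := qPochhammerInf_mul_range_eq w hq one_ne_zero (k := 5) (by norm_num)
  have w2 := qPochhammerInf_mul_range_eq w⁻¹ hq one_ne_zero (k := 5) (by norm_num)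
  have c1 := E_cube hw hq
  have c5 := E_cube hw hq5
  simp only [Finset.prod_range_succ, Finset.prod_range_zero, one_mul, Nat.reduceAdd, pow_one,
    zero_add] at e1 w1 w2
  rw [← pow_mul, ← pow_mul, ← pow_mul] at c5
  norm_num at c5
  change E q = _ at e1
  rw [show qPochhammerInf (q ^ 5) (q ^ 5) = E (q ^ 5) from rfl] at e1
  have hE : ∀ {k : ℕ}, k ≠ 0 → E (q ^ k) ≠ 0 := fun hk => E_ne_zero _ (norm_pow_lt_one hq hk)
  have h5 : E (q ^ 5) ^ 4 ≠ 0 := pow_ne_zero 4 (hE (by norm_num))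
  have h6 := hE (k := 6) (by norm_num)
  have h10 := hE (k := 10) (by norm_num)
  have h15 := hE (k := 15) (by norm_num)
  have h1 := E_ne_zero q hq
  have hW := sixth_root_sub_inv_ne_zero hw
  have hA : (∑' n : ℕ+, termQ q n) * (qPochhammerInf (w * q) (q ^ 5) *
      qPochhammerInf (w * q ^ 2) (q ^ 5) * qPochhammerInf (w * q ^ 3) (q ^ 5) *
      qPochhammerInf (w * q ^ 4) (q ^ 5) * qPochhammerInf (w⁻¹ * q) (q ^ 5) *
      qPochhammerInf (w⁻¹ * q ^ 2) (q ^ 5) * qPochhammerInf (w⁻¹ * q ^ 3) (q ^ 5) *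
      qPochhammerInf (w⁻¹ * q ^ 4) (q ^ 5)) = q * E q * E (q ^ 15) := by
    refine mul_left_cancel₀ (mul_ne_zero (mul_ne_zero hW hw0) h5) ?_
    have hww : (w - w⁻¹) * w = -(1 - w ^ 2) := by field_simp; ring
    simp only [pow_one] at key
    rw [e1]
    linear_combination key - (q * (qPochhammerInf q (q ^ 5) * qPochhammerInf (q ^ 2) (q ^ 5) *
      qPochhammerInf (q ^ 3) (q ^ 5) * qPochhammerInf (q ^ 4) (q ^ 5) * E (q ^ 5)) * E (q ^ 15)
      * E (q ^ 5) ^ 4) * hww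
  rw [Q, mul_div_assoc', div_eq_iff (mul_ne_zero h6 h10)]
  -- The factors E(q) and E(q^15) are brought in so that `E_cube` at q and at q^5 applies without
  -- division.
  refine mul_left_cancel₀ (mul_ne_zero h1 h15) ?_
  rw [w1, w2] at c1
  linear_combination (q * E q * E (q ^ 15) * E (q ^ 2) * E (q ^ 3)) * (-c5)
    + ((∑' n : ℕ+, termQ q n) * E (q ^ 10) * E (q ^ 15)) * c1
    - (E (q ^ 2) * E (q ^ 3) * E (q ^ 10) * E (q ^ 15) * qPochhammerInf (w * q ^ 5) (q ^ 5)
      * qPochhammerInf (w⁻¹ * q ^ 5) (q ^ 5)) * hA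

end RamanujanLambert

/-! ### Double series with quadratic exponents and identities between φ and ψ -/

namespace RamanujanLambert

open Filter Topology

/-- The double series `∑ q ^ e(m, n)` over all pairs of integers. -/
noncomputable def latticeSum (q : ℂ) (e : ℤ → ℤ → ℤ) : ℂ := ∑' p : ℤ × ℤ, q ^ e p.1 p.2

/-- Convergence of the double series `∑ q ^ e(m, n)`. -/
def LatticeSummable (q : ℂ) (e : ℤ → ℤ → ℤ) : Prop := Summable fun p : ℤ × ℤ => q ^ e p.1 p.2

variable {q : ℂ} {e e' : ℤ → ℤ → ℤ}

/-- A left inverse suffices, so the new variables may run over a proper sublattice. -/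
theorem LatticeSummable.reindex (h : LatticeSummable q e) (f₁ f₂ g₁ g₂ : ℤ → ℤ → ℤ)
    (h₁ : ∀ m n, g₁ (f₁ m n) (f₂ m n) = m) (h₂ : ∀ m n, g₂ (f₁ m n) (f₂ m n) = n)
    (he : ∀ m n, e (f₁ m n) (f₂ m n) = e' m n) : LatticeSummable q e' := by
  have inj : Function.Injective fun p : ℤ × ℤ => (f₁ p.1 p.2, f₂ p.1 p.2) :=
    Function.LeftInverse.injective (g := fun p => (g₁ p.1 p.2, g₂ p.1 p.2)) fun p =>
      Prod.ext (h₁ _ _) (h₂ _ _)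
  exact (Summable.comp_injective h inj).congr fun p => by simp [he]

theorem latticeSum_reindex (f₁ f₂ g₁ g₂ : ℤ → ℤ → ℤ)
    (h₁ : ∀ m n, g₁ (f₁ m n) (f₂ m n) = m) (h₂ : ∀ m n, g₂ (f₁ m n) (f₂ m n) = n)
    (h₃ : ∀ m n, f₁ (g₁ m n) (g₂ m n) = m) (h₄ : ∀ m n, f₂ (g₁ m n) (g₂ m n) = n)
    (he : ∀ m n, e (f₁ m n) (f₂ m n) = e' m n) : latticeSum q e' = latticeSum q e := by
  let σ : ℤ × ℤ ≃ ℤ × ℤ :=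
    ⟨fun p => (f₁ p.1 p.2, f₂ p.1 p.2), fun p => (g₁ p.1 p.2, g₂ p.1 p.2),
      fun p => Prod.ext (h₁ _ _) (h₂ _ _), fun p => Prod.ext (h₃ _ _) (h₄ _ _)⟩
  rw [latticeSum, latticeSum, ← σ.tsum_eq fun p : ℤ × ℤ => q ^ e p.1 p.2]
  exact tsum_congr fun p => by simp [σ, he]

theorem latticeSum_split (h : LatticeSummable q e) : latticeSum q e
    = latticeSum q (fun m n => e m (2 * n)) + latticeSum q (fun m n => e m (2 * n + 1)) :=
  tsum_split_snd h

theorem latticeSum_split_parity (h : LatticeSummable q e) : latticeSum q e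
    = latticeSum q (fun n s => e (n + 2 * s) n) + latticeSum q (fun n s => e (n + (2 * s + 1)) n) :=
  tsum_split_parity h

theorem latticeSum_neg_of_even (h : ∀ m n, Even (e m n)) : latticeSum (-q) e = latticeSum q e :=
  tsum_congr fun _ => (h _ _).neg_zpow q

theorem latticeSum_neg_of_odd (h : ∀ m n, Odd (e m n)) : latticeSum (-q) e = -latticeSum q e := by
  rw [latticeSum, latticeSum, ← tsum_neg]
  exact tsum_congr fun _ => (h _ _).neg_zpow q

theorem latticeSum_const_add (hq0 : q ≠ 0) (c : ℕ) :
    latticeSum q (fun m n => e m n + c) = q ^ c * latticeSum q e := by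
  rw [latticeSum, latticeSum, ← tsum_mul_left]
  exact tsum_congr fun p => by rw [zpow_add₀ hq0, zpow_natCast, mul_comm]

/-- `Ψ(q) = ∑ q ^ (n (n - 1) / 2)` over all integers, twice Ramanujan's `ψ(q)`. -/
noncomputable def Psi (q : ℂ) : ℂ := ∑' n : ℤ, q ^ (n * (n - 1) / 2)

theorem summable_norm_Psi (hq0 : q ≠ 0) (hq : ‖q‖ < 1) :
    Summable fun n : ℤ => ‖q ^ (n * (n - 1) / 2)‖ := by
  simpa using summable_norm_theta hq0 hq one_ne_zero

theorem phi_eq_tsum (hq0 : q ≠ 0) : phi q = ∑' n : ℤ, q ^ (n * n) := by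
  refine tsum_congr fun n => ?_
  rw [← zpow_add₀ hq0]
  congr 1
  have h1 := two_mul_tri n
  have h2 := two_mul_tri (n + 1)
  have h3 : (n + 1) * (n + 1 - 1) = n * (n + 1) := by ring
  rw [h3] at h2
  have : 2 * (n * (n + 1) / 2 + n * (n - 1) / 2) = 2 * (n * n) := by linear_combination h1 + h2
  omega

theorem summable_norm_phi (hq0 : q ≠ 0) (hq : ‖q‖ < 1) :
    Summable fun n : ℤ => ‖q ^ (n * n)‖ := by
  simpa using summable_norm_sq_mul hq0 hq one_ne_zero

variable {j k : ℕ}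

theorem latticeSum_phi (hq0 : q ≠ 0) (hq : ‖q‖ < 1) (hj : j ≠ 0) (hk : k ≠ 0) :
    LatticeSummable q (fun m n => j * (m * m) + k * (n * n)) ∧
    phi (q ^ j) * phi (q ^ k) = latticeSum q (fun m n => j * (m * m) + k * (n * n)) := by
  have hj0 := pow_ne_zero j hq0
  have hk0 := pow_ne_zero k hq0
  have sj := summable_norm_phi hj0 (norm_pow_lt_one hq hj)
  have sk := summable_norm_phi hk0 (norm_pow_lt_one hq hk)
  have he : ∀ p : ℤ × ℤ, q ^ ((j : ℤ) * (p.1 * p.1) + k * (p.2 * p.2))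
      = (q ^ j) ^ (p.1 * p.1) * (q ^ k) ^ (p.2 * p.2) := fun p => by
    rw [zpow_add₀ hq0, zpow_mul q j, zpow_mul q k, zpow_natCast, zpow_natCast]
  constructor
  · exact (summable_mul_of_summable_norm (f := fun m : ℤ => (q ^ j) ^ (m * m))
      (g := fun n : ℤ => (q ^ k) ^ (n * n)) sj sk).congr fun p => (he p).symm
  · rw [phi_eq_tsum hj0, phi_eq_tsum hk0, tsum_mul_tsum_of_summable_norm sj sk]
    exact tsum_congr fun p => (he p).symm

theorem latticeSum_Psi (hq0 : q ≠ 0) (hq : ‖q‖ < 1) (hj : j ≠ 0) (hk : k ≠ 0) :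
    LatticeSummable q (fun m n => j * (m * (m - 1) / 2) + k * (n * (n - 1) / 2)) ∧
    Psi (q ^ j) * Psi (q ^ k)
      = latticeSum q (fun m n => j * (m * (m - 1) / 2) + k * (n * (n - 1) / 2)) := by
  have sj := summable_norm_Psi (pow_ne_zero j hq0) (norm_pow_lt_one hq hj)
  have sk := summable_norm_Psi (pow_ne_zero k hq0) (norm_pow_lt_one hq hk)
  have he : ∀ p : ℤ × ℤ, q ^ ((j : ℤ) * (p.1 * (p.1 - 1) / 2) + k * (p.2 * (p.2 - 1) / 2))
      = (q ^ j) ^ (p.1 * (p.1 - 1) / 2) * (q ^ k) ^ (p.2 * (p.2 - 1) / 2) := fun p => by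
    rw [zpow_add₀ hq0, zpow_mul q j, zpow_mul q k, zpow_natCast, zpow_natCast]
  constructor
  · exact (summable_mul_of_summable_norm (f := fun m : ℤ => (q ^ j) ^ (m * (m - 1) / 2))
      (g := fun n : ℤ => (q ^ k) ^ (n * (n - 1) / 2)) sj sk).congr fun p => (he p).symm
  · rw [Psi, Psi, tsum_mul_tsum_of_summable_norm sj sk]
    exact tsum_congr fun p => (he p).symm

/-- The parity dissection of `φ(q ^ j) φ(q ^ k)`. -/
theorem phi_mul_phi_split (hq0 : q ≠ 0) (hq : ‖q‖ < 1) (hj : j ≠ 0) (hk : k ≠ 0) :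
    phi (q ^ j) * phi (q ^ k)
      = latticeSum q (fun n s => j * ((n + 2 * s) * (n + 2 * s)) + k * (n * n))
        + latticeSum q (fun n s => j * ((n + (2 * s + 1)) * (n + (2 * s + 1))) + k * (n * n)) := by
  obtain ⟨h1, h2⟩ := latticeSum_phi hq0 hq hj hk
  rw [h2, latticeSum_split_parity h1]

/-- The symmetry n ↦ 1 - n of n(n-1)/2 exchanges the two parity classes, so they contribute equally.
-/
theorem Psi_mul_Psi_aux (hq0 : q ≠ 0) (hq : ‖q‖ < 1) (hj : j ≠ 0) (hk : k ≠ 0) :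
    Psi (q ^ j) * Psi (q ^ k) = 2 * latticeSum q (fun n s =>
      j * ((n + 2 * s) * (n + 2 * s - 1) / 2) + k * (n * (n - 1) / 2)) := by
  obtain ⟨h1, h2⟩ := latticeSum_Psi hq0 hq hj hk
  rw [h2, latticeSum_split_parity h1, two_mul]
  congr 1
  refine latticeSum_reindex (fun n s => 1 - n) (fun n s => n + s) (fun n s => 1 - n)
    (fun n s => s + n - 1) ?_ ?_ ?_ ?_ ?_
  · intro m n; ring
  · intro m n; ring
  · intro m n; ring
  · intro m n; ring
  · intro m n
    congr 2
    · congr 1; ring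
    · congr 1; ring

/-- If `j + k` is even then `Ψ(q ^ j) Ψ(q ^ k)` is twice a double series with polynomial
exponents. -/
theorem Psi_mul_Psi (hq0 : q ≠ 0) (hq : ‖q‖ < 1) (hj : j ≠ 0) (hk : k ≠ 0) {l : ℕ}
    (hl : j + k = 2 * l) :
    LatticeSummable q (fun n s => l * (n * n - n) + j * (2 * s * n + s * (2 * s - 1))) ∧
    Psi (q ^ j) * Psi (q ^ k)
      = 2 * latticeSum q (fun n s => l * (n * n - n) + j * (2 * s * n + s * (2 * s - 1))) := by
  have he : ∀ n s : ℤ, j * ((n + 2 * s) * (n + 2 * s - 1) / 2) + k * (n * (n - 1) / 2)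
      = l * (n * n - n) + j * (2 * s * n + s * (2 * s - 1)) := by
    intro n s
    have h1 := two_mul_tri n
    have h2 := two_mul_tri (n + 2 * s)
    have h3 : (j : ℤ) + k = 2 * l := by exact_mod_cast hl
    refine mul_left_cancel₀ (two_ne_zero (α := ℤ)) ?_
    linear_combination (j : ℤ) * h2 + (k : ℤ) * h1 + (n * n - n) * h3
  constructor
  · refine (latticeSum_Psi hq0 hq hj hk).1.reindex (fun n s => n + 2 * s) (fun n _ => n)
      (fun _ n => n) (fun m n => (m - n) / 2) ?_ ?_ he
    · intro m n; rfl
    · intro m n; simp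
  · rw [Psi_mul_Psi_aux hq0 hq hj hk]
    simp only [he]

theorem neg_pow_odd (q : ℂ) {j : ℕ} (hj : Odd j) : -q ^ j = (-q) ^ j := (hj.neg_pow q).symm

/-- Splitting by the parity of s separates even exponents from odd ones, so q ↦ -q merely changes
the sign of the second sum. -/
theorem Psi_one_fifteen (hq0 : q ≠ 0) (hq : ‖q‖ < 1) :
    Psi q * Psi (q ^ 15) = 2 * (latticeSum q (fun n w => 8 * n * n - 8 * n + 4 * w * n + 8 * w * w - 2 * w)
      + latticeSum q (fun n w => 8 * n * n - 6 * n + 4 * w * n + 8 * w * w + 6 * w + 1)) := by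
  obtain ⟨h1, h2⟩ := Psi_mul_Psi hq0 hq one_ne_zero (k := 15) (by norm_num) (l := 8) rfl
  rw [pow_one] at h2
  rw [h2, latticeSum_split h1]
  congr 3 <;> (ext n w; push_cast; ring)

theorem Psi_neg_one_fifteen (hq0 : q ≠ 0) (hq : ‖q‖ < 1) :
    Psi (-q) * Psi (-q ^ 15)
      = 2 * (latticeSum q (fun n w => 8 * n * n - 8 * n + 4 * w * n + 8 * w * w - 2 * w)
      - latticeSum q (fun n w => 8 * n * n - 6 * n + 4 * w * n + 8 * w * w + 6 * w + 1)) := by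
  rw [neg_pow_odd q (by decide), Psi_one_fifteen (neg_ne_zero.2 hq0) (by rwa [norm_neg]),
    latticeSum_neg_of_even, latticeSum_neg_of_odd, ← sub_eq_add_neg]
  · exact fun n w => ⟨4 * n * n - 3 * n + 2 * w * n + 4 * w * w + 3 * w, by ring⟩
  · exact fun n w => ⟨4 * n * n - 4 * n + 2 * w * n + 4 * w * w - w, by ring⟩

theorem Psi_three_five (hq0 : q ≠ 0) (hq : ‖q‖ < 1) :
    Psi (q ^ 3) * Psi (q ^ 5)
      = 2 * (latticeSum q (fun n w => 4 * n * n - 4 * n + 12 * w * n + 24 * w * w - 6 * w)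
      + latticeSum q (fun n w => 4 * n * n + 2 * n + 12 * w * n + 24 * w * w + 18 * w + 3)) := by
  obtain ⟨h1, h2⟩ := Psi_mul_Psi hq0 hq three_ne_zero (k := 5) (by norm_num) (l := 4) rfl
  rw [h2, latticeSum_split h1]
  congr 3 <;> (ext n w; push_cast; ring)

theorem Psi_neg_three_five (hq0 : q ≠ 0) (hq : ‖q‖ < 1) :
    Psi (-q ^ 3) * Psi (-q ^ 5)
      = 2 * (latticeSum q (fun n w => 4 * n * n - 4 * n + 12 * w * n + 24 * w * w - 6 * w)
      - latticeSum q (fun n w => 4 * n * n + 2 * n + 12 * w * n + 24 * w * w + 18 * w + 3)) := by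
  rw [neg_pow_odd q (by decide), neg_pow_odd q (by decide),
    Psi_three_five (neg_ne_zero.2 hq0) (by rwa [norm_neg]),
    latticeSum_neg_of_even, latticeSum_neg_of_odd, ← sub_eq_add_neg]
  · exact fun n w => ⟨2 * n * n + n + 6 * w * n + 12 * w * w + 9 * w + 1, by ring⟩
  · exact fun n w => ⟨2 * n * n - 2 * n + 6 * w * n + 12 * w * w - 3 * w, by ring⟩

/-- Ramanujan's identity `ψ(q) ψ(q ^ 15) + ψ(-q) ψ(-q ^ 15) = 2 ψ(q ^ 6) ψ(q ^ 10)`. -/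
theorem Psi_add_Psi_neg (hq0 : q ≠ 0) (hq : ‖q‖ < 1) :
    Psi q * Psi (q ^ 15) + Psi (-q) * Psi (-q ^ 15) = 2 * (Psi (q ^ 6) * Psi (q ^ 10)) := by
  have h := (Psi_mul_Psi hq0 hq (j := 6) (by norm_num) (k := 10) (by norm_num) (l := 8) rfl).2
  have e1 : latticeSum q (fun n w => 8 * n * n - 8 * n + 4 * w * n + 8 * w * w - 2 * w)
      = latticeSum q (fun n s => (8 : ℕ) * (n * n - n) + (6 : ℕ) * (2 * s * n + s * (2 * s - 1))) := by
    refine latticeSum_reindex (fun n w => n + w) (fun _ w => -w) (fun n s => n + s)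
      (fun _ s => -s) ?_ ?_ ?_ ?_ ?_ <;> (intro m n; push_cast; ring)
  rw [Psi_one_fifteen hq0 hq, Psi_neg_one_fifteen hq0 hq, h, ← e1]
  ring

theorem latticeSum_three_five_odd (hq0 : q ≠ 0) :
    latticeSum q (fun n w => 4 * n * n + 2 * n + 12 * w * n + 24 * w * w + 18 * w + 3)
      = q ^ 3 * latticeSum q
        (fun n s => (16 : ℕ) * (n * n - n) + (2 : ℕ) * (2 * s * n + s * (2 * s - 1))) := by
  rw [← latticeSum_const_add hq0]
  symm
  refine latticeSum_reindex (fun n s => s - n + 1) (fun n _ => n - 1) (fun _ w => w + 1)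
    (fun m w => m + w) ?_ ?_ ?_ ?_ ?_ <;> (intro m n; push_cast; ring)

/-- Ramanujan's identity
`ψ(q ^ 3) ψ(q ^ 5) - ψ(-q ^ 3) ψ(-q ^ 5) = 2 q ^ 3 ψ(q ^ 2) ψ(q ^ 30)`. -/
theorem Psi_sub_Psi_neg (hq0 : q ≠ 0) (hq : ‖q‖ < 1) :
    Psi (q ^ 3) * Psi (q ^ 5) - Psi (-q ^ 3) * Psi (-q ^ 5)
      = 2 * q ^ 3 * (Psi (q ^ 2) * Psi (q ^ 30)) := by
  have h := (Psi_mul_Psi hq0 hq (j := 2) (by norm_num) (k := 30) (by norm_num) (l := 16) rfl).2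
  rw [Psi_three_five hq0 hq, Psi_neg_three_five hq0 hq, h, latticeSum_three_five_odd hq0]
  ring

/-- For odd j and k the exponent j m² + k n² has the parity of m + n. -/
theorem phi_neg_odd (hq0 : q ≠ 0) (hq : ‖q‖ < 1) (hj : Odd j) (hk : Odd k) :
    phi (-q ^ j) * phi (-q ^ k)
      = latticeSum q (fun n s => j * ((n + 2 * s) * (n + 2 * s)) + k * (n * n))
        - latticeSum q (fun n s => j * ((n + (2 * s + 1)) * (n + (2 * s + 1))) + k * (n * n)) := by
  have hj' : Odd (j : ℤ) := by exact_mod_cast hj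
  have hk' : Odd (k : ℤ) := by exact_mod_cast hk
  rw [neg_pow_odd q hj, neg_pow_odd q hk, phi_mul_phi_split (neg_ne_zero.2 hq0)
    (by rwa [norm_neg]) hj.pos.ne' hk.pos.ne', latticeSum_neg_of_even, latticeSum_neg_of_odd,
    ← sub_eq_add_neg]
  · intro n s
    have h1 := Int.not_even_iff_odd.2 hj'
    have h2 := Int.not_even_iff_odd.2 hk'
    rw [← Int.not_even_iff_odd]
    simp only [Int.even_add, Int.even_mul, h1, h2]
    simp
    rw [← Int.not_even_iff_odd]
    tauto
  · intro n s
    have h1 := Int.not_even_iff_odd.2 hj'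
    have h2 := Int.not_even_iff_odd.2 hk'
    simp only [Int.even_add, Int.even_mul, h1, h2]
    simp

theorem phi_neg_two_mul (hq0 : q ≠ 0) (hq : ‖q‖ < 1) (hj : Odd j) (hk : Odd k) :
    phi (-q ^ (2 * j)) * phi (-q ^ (2 * k))
      = latticeSum q (fun n s => 2 * j * ((n + 2 * s) * (n + 2 * s)) + 2 * k * (n * n))
        - latticeSum q
          (fun n s => 2 * j * ((n + (2 * s + 1)) * (n + (2 * s + 1))) + 2 * k * (n * n)) := by
  rw [pow_mul, pow_mul, phi_neg_odd (pow_ne_zero 2 hq0) (norm_pow_lt_one hq two_ne_zero) hj hk]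
  have h : ∀ e : ℤ → ℤ → ℤ, latticeSum (q ^ 2) e = latticeSum q fun m n => 2 * e m n := fun e =>
    tsum_congr fun p => by rw [zpow_mul]; norm_cast
  rw [h, h]
  congr 2 <;> (ext; ring)

/-- The identity
`φ(-q ^ 2) φ(-q ^ 30) + 2 q ^ 2 ψ(-q) ψ(-q ^ 15) = φ(-q ^ 3) φ(-q ^ 5)`. -/
theorem phi_neg_three_five (hq0 : q ≠ 0) (hq : ‖q‖ < 1) :
    phi (-q ^ 2) * phi (-q ^ 30) + q ^ 2 / 2 * (Psi (-q) * Psi (-q ^ 15))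
      = phi (-q ^ 3) * phi (-q ^ 5) := by
  have f := phi_neg_two_mul hq0 hq odd_one (k := 15) (by decide)
  have g := phi_neg_odd hq0 hq (j := 3) (by decide) (k := 5) (by decide)
  obtain ⟨s1, -⟩ := Psi_mul_Psi hq0 hq one_ne_zero (k := 15) (by norm_num) (l := 8) rfl
  have s3 := (latticeSum_phi hq0 hq (j := 3) (by norm_num) (k := 5) (by norm_num)).1
  norm_num at f g
  have sa : LatticeSummable q (fun n w => 8 * n * n - 8 * n + 4 * w * n + 8 * w * w - 2 * w) := by
    refine s1.reindex (fun n w => n) (fun n w => 2 * w) (fun n w => n) (fun n w => w / 2) ?_ ?_ ?_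
    · intro m n; rfl
    · intro m n; simp
    · intro m n; push_cast; ring
  have sb : LatticeSummable q (fun A B => 8 * A * A + 4 * A * B + 8 * B * B) := by
    refine s3.reindex (fun A B => A - B) (fun A B => A + B) (fun m n => (m + n) / 2)
      (fun m n => (n - m) / 2) ?_ ?_ ?_
    · intro m n; ring_nf; simp
    · intro m n; ring_nf; simp
    · intro m n; push_cast; ring
  have e1 : latticeSum q (fun n s => 3 * ((n + (2 * s + 1)) * (n + (2 * s + 1))) + 5 * (n * n))
      = q ^ 2 * latticeSum q (fun n w => 8 * n * n - 6 * n + 4 * w * n + 8 * w * w + 6 * w + 1) := by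
    rw [← latticeSum_const_add hq0]
    refine latticeSum_reindex (fun _ s => -s) (fun n s => n + s) (fun n s => n + s)
      (fun n _ => -n) ?_ ?_ ?_ ?_ ?_ <;> (intro m n; push_cast; ring)
  have e2 : latticeSum q (fun n s => 2 * ((n + (2 * s + 1)) * (n + (2 * s + 1))) + 30 * (n * n))
      = q ^ 2 * latticeSum q (fun n w => 8 * n * n - 8 * n + 4 * (2 * w) * n + 8 * (2 * w) * (2 * w)
        - 2 * (2 * w)) := by
    rw [← latticeSum_const_add hq0]
    refine latticeSum_reindex (fun _ s => s + 1) (fun n _ => n) (fun _ w => w)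
      (fun n _ => n - 1) ?_ ?_ ?_ ?_ ?_ <;> (intro m n; push_cast; ring)
  have e3 : latticeSum q (fun n s => 3 * ((n + 2 * s) * (n + 2 * s)) + 5 * (n * n))
      = latticeSum q (fun A B => 8 * A * A + 4 * A * B + 8 * B * B) := by
    refine latticeSum_reindex (fun n s => n + s) (fun _ s => -s) (fun n s => n + s)
      (fun _ s => -s) ?_ ?_ ?_ ?_ ?_ <;> (intro m n; ring)
  have e4 : latticeSum q (fun n s => 2 * ((n + 2 * s) * (n + 2 * s)) + 30 * (n * n))
      = latticeSum q (fun A B => 8 * A * A + 4 * A * (2 * B) + 8 * (2 * B) * (2 * B)) := by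
    refine latticeSum_reindex (fun _ s => s) (fun n _ => n) (fun _ s => s)
      (fun n _ => n) ?_ ?_ ?_ ?_ ?_ <;> (intro m n; ring)
  have e5 : latticeSum q
        (fun A B => 8 * A * A + 4 * A * (2 * B + 1) + 8 * (2 * B + 1) * (2 * B + 1))
      = q ^ 2 * latticeSum q (fun n w => 8 * n * n - 8 * n + 4 * (2 * w + 1) * n
        + 8 * (2 * w + 1) * (2 * w + 1) - 2 * (2 * w + 1)) := by
    rw [← latticeSum_const_add hq0]
    refine latticeSum_reindex (fun A B => A + B + 1) (fun _ B => -B - 1) (fun n w => n + w)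
      (fun _ w => -w - 1) ?_ ?_ ?_ ?_ ?_ <;> (intro m n; push_cast; ring)
  -- Writing a and b for the even and odd parts of ψ(q)ψ(q^15), the part of q²a with even w cancels
  -- the odd class of φ(-q²)φ(-q^30). The part with odd w completes the even class to that of
  -- φ(-q³)φ(-q⁵), and q²b is its odd class.
  rw [f, g, Psi_neg_one_fifteen hq0 hq, latticeSum_split sa, e1, e2, e3, latticeSum_split sb, e4, e5]
  ring

/-- The identity
`φ(-q ^ 6) φ(-q ^ 10) - 2 q ψ(-q ^ 3) ψ(-q ^ 5) = φ(-q) φ(-q ^ 15)`. -/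
theorem phi_neg_one_fifteen (hq0 : q ≠ 0) (hq : ‖q‖ < 1) :
    phi (-q ^ 6) * phi (-q ^ 10) - q / 2 * (Psi (-q ^ 3) * Psi (-q ^ 5))
      = phi (-q) * phi (-q ^ 15) := by
  have f := phi_neg_two_mul hq0 hq (j := 3) (by decide) (k := 5) (by decide)
  have g := phi_neg_odd hq0 hq odd_one (k := 15) (by decide)
  obtain ⟨sd, -⟩ := Psi_mul_Psi hq0 hq two_ne_zero (k := 30) (by norm_num) (l := 16) rfl
  have s1 := (latticeSum_phi hq0 hq one_ne_zero (k := 15) (by norm_num)).1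
  norm_num at f g
  have sb : LatticeSummable q (fun n s => (n + 2 * s) * (n + 2 * s) + 15 * (n * n)) := by
    refine s1.reindex (fun n s => n + 2 * s) (fun n s => n) (fun m n => n)
      (fun m n => (m - n) / 2) ?_ ?_ ?_
    · intro m n; rfl
    · intro m n; simp
    · intro m n; push_cast; ring
  have e1 : latticeSum q (fun n s => (n + (2 * s + 1)) * (n + (2 * s + 1)) + 15 * (n * n))
      = q * latticeSum q (fun n w => 4 * n * n - 4 * n + 12 * w * n + 24 * w * w - 6 * w) := by
    have h := latticeSum_const_add
      (e := fun n w => 4 * n * n - 4 * n + 12 * w * n + 24 * w * w - 6 * w) hq0 1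
    rw [pow_one] at h
    rw [← h]
    refine latticeSum_reindex (fun n s => s + 1 - n) (fun n _ => n) (fun _ w => w)
      (fun n w => n + w - 1) ?_ ?_ ?_ ?_ ?_ <;> (intro m n; push_cast; ring)
  have e2 : latticeSum q (fun n s => 6 * ((n + (2 * s + 1)) * (n + (2 * s + 1))) + 10 * (n * n))
      = q ^ 4 * latticeSum q (fun n s => (16 : ℕ) * (n * n - n)
        + (2 : ℕ) * (2 * (2 * s + 1) * n + (2 * s + 1) * (2 * (2 * s + 1) - 1))) := by
    rw [← latticeSum_const_add hq0]
    refine latticeSum_reindex (fun _ s => -s) (fun n s => n + s) (fun n s => n + s)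
      (fun n _ => -n) ?_ ?_ ?_ ?_ ?_ <;> (intro m n; push_cast; ring)
  have e3 : latticeSum q (fun n s => 6 * ((n + 2 * s) * (n + 2 * s)) + 10 * (n * n))
      = latticeSum q (fun n s => (n + 2 * (2 * s)) * (n + 2 * (2 * s)) + 15 * (n * n)) := by
    refine latticeSum_reindex (fun _ s => -s) (fun n s => n + s) (fun n s => n + s)
      (fun n _ => -n) ?_ ?_ ?_ ?_ ?_ <;> (intro m n; ring)
  have e4 : latticeSum q
        (fun n s => (n + 2 * (2 * s + 1)) * (n + 2 * (2 * s + 1)) + 15 * (n * n))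
      = q ^ 4 * latticeSum q (fun n s => (16 : ℕ) * (n * n - n)
        + (2 : ℕ) * (2 * (2 * s) * n + (2 * s) * (2 * (2 * s) - 1))) := by
    rw [← latticeSum_const_add hq0]
    refine latticeSum_reindex (fun _ s => s + 1) (fun n _ => n) (fun _ w => w)
      (fun n _ => n - 1) ?_ ?_ ?_ ?_ ?_ <;> (intro m n; push_cast; ring)
  -- Same mechanism: one half of the odd part of ψ(q³)ψ(q⁵) cancels the odd class of φ(-q⁶)φ(-q^10),
  -- the other half completes its even class, and the even part is the odd class of φ(-q)φ(-q^15).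
  rw [f, g, Psi_neg_three_five hq0 hq, latticeSum_three_five_odd hq0, latticeSum_split sd, e1, e2,
    e3, latticeSum_split sb, e4]
  ring

end RamanujanLambert

/-! ### Product forms, duplication formulas and the algebraic elimination -/

namespace RamanujanLambert

open Filter Topology

variable {q : ℂ}

theorem E_zero : E 0 = 1 := by simp [E, qPochhammerInf]

theorem E_eq_mul_sq (hq : ‖q‖ < 1) : E q = qPochhammerInf q (q ^ 2) * E (q ^ 2) := by
  rw [E, qPochhammerInf_eq_prod q hq two_ne_zero, Finset.prod_range_succ, Finset.prod_range_one,
    pow_zero, mul_one, pow_one, ← sq]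
  rfl

theorem phi_zero : phi 0 = 1 := by
  have h := (hasSum_phi 0 (by simp)).tsum_eq
  rw [← h, tsum_eq_single 0]
  · simp
  · intro n hn
    simp [hn]

theorem phi_neg_mul (hq : ‖q‖ < 1) : phi (-q) * E (q ^ 2) = E q ^ 2 := by
  rcases eq_or_ne q 0 with rfl | hq0
  · simp [phi_zero, E_zero]
  have h : phi (-q) = thetaJ (q ^ 2) q := by
    rw [phi_eq_tsum (neg_ne_zero.2 hq0)]
    refine tsum_congr fun n => ?_
    rw [← neg_sq q, ← zpow_natCast, ← zpow_mul, ← zpow_add₀ (neg_ne_zero.2 hq0)]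
    congr 1
    have := two_mul_tri n
    push_cast
    linear_combination -this
  rw [h, thetaJ_eq (pow_ne_zero 2 hq0) (norm_sq_lt_one hq) hq0, E_eq_mul_sq hq,
    show q ^ 2 / q = q by field_simp]
  ring

theorem phi_neg_eq (hq : ‖q‖ < 1) : phi (-q) = E q ^ 2 / E (q ^ 2) :=
  eq_div_of_mul_eq (E_ne_zero _ (norm_sq_lt_one hq)) (phi_neg_mul hq)

/-- The triple product at z = -1; the leading factor 1 - z is the 2. -/
theorem Psi_eq (hq0 : q ≠ 0) (hq : ‖q‖ < 1) : Psi q = 2 * E (q ^ 2) ^ 2 / E q := by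
  refine eq_div_of_mul_eq (E_ne_zero _ hq) ?_
  have h : Psi q = thetaJ q (-1) := tsum_congr fun n => by simp
  rw [h, thetaJ_eq hq0 hq (by norm_num), qPochhammerInf_eq_mul (-1) hq, ← E_mul_neg hq,
    show q / -1 = -q by ring, neg_one_mul]
  ring

theorem E_neg_mul (hq : ‖q‖ < 1) : E (-q) * E q * E (q ^ 4) = E (q ^ 2) ^ 3 := by
  have h1 := E_eq_mul_sq hq
  have h2 := E_eq_mul_sq (q := -q) (by rwa [norm_neg])
  have h3 := E_eq_mul_sq (norm_sq_lt_one hq)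
  have h4 := qPochhammerInf_mul_neg q (norm_sq_lt_one hq)
  rw [neg_sq] at h2
  rw [← pow_mul] at h3 h4
  norm_num at h3 h4
  rw [h1, h2]
  linear_combination E (q ^ 2) ^ 2 * E (q ^ 4) * h4 - E (q ^ 2) ^ 2 * h3

theorem E_neg (hq : ‖q‖ < 1) : E (-q) = E (q ^ 2) ^ 3 / (E q * E (q ^ 4)) := by
  refine eq_div_of_mul_eq (mul_ne_zero (E_ne_zero _ hq)
    (E_ne_zero _ (norm_pow_lt_one hq (by norm_num)))) ?_
  rw [← E_neg_mul hq]
  ring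

theorem phi_eq (hq : ‖q‖ < 1) : phi q = E (q ^ 2) ^ 5 / (E q ^ 2 * E (q ^ 4) ^ 2) := by
  have h := phi_neg_eq (q := -q) (by rwa [norm_neg])
  have h2 := E_ne_zero _ (norm_sq_lt_one hq)
  rw [neg_neg, neg_sq, E_neg hq] at h
  rw [h]
  field_simp

theorem Psi_neg_eq (hq0 : q ≠ 0) (hq : ‖q‖ < 1) : Psi (-q) = 2 * E q * E (q ^ 4) / E (q ^ 2) := by
  have h2 := E_ne_zero _ (norm_sq_lt_one hq)
  rw [Psi_eq (neg_ne_zero.2 hq0) (by rwa [norm_neg]), neg_sq, E_neg hq]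
  field_simp

theorem phi_ne_zero (hq : ‖q‖ < 1) : phi q ≠ 0 := by
  have h1 := E_ne_zero _ hq
  have h2 := E_ne_zero _ (norm_sq_lt_one hq)
  have h4 := E_ne_zero _ (norm_pow_lt_one hq (k := 4) (by norm_num))
  rw [phi_eq hq]
  positivity

/-- The duplication formulas for `φ` and `Ψ`. -/
theorem theta_duplication (hq0 : q ≠ 0) (hq : ‖q‖ < 1) :
    Psi q ^ 2 = 2 * phi q * Psi (q ^ 2) ∧ phi (-q ^ 2) ^ 2 = phi q * phi (-q) ∧
      Psi (-q) * phi q = Psi q * phi (-q ^ 2) := by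
  have h1 := E_ne_zero _ hq
  have hq2 := norm_sq_lt_one hq
  have h2 := E_ne_zero _ hq2
  have h4 := E_ne_zero _ (norm_pow_lt_one hq (k := 4) (by norm_num))
  rw [phi_eq hq, Psi_eq hq0 hq, Psi_eq (pow_ne_zero 2 hq0) hq2, phi_neg_eq hq2, phi_neg_eq hq,
    Psi_neg_eq hq0 hq, ← pow_mul]
  norm_num
  refine ⟨?_, ?_, ?_⟩ <;> field_simp

/-- The algebraic relations implied by the four theta function identities. -/
theorem modular_relations {z₁ z₃ a a' b b' : ℂ} (hz₃ : z₃ ≠ 0) (hb : b ≠ 0) (hb' : b' ≠ 0)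
    (hbb : b ≠ b') (h₁ : z₁ * a * (1 + a') = z₃ * b ^ 2) (h₂ : z₃ * b * (1 - b') = z₁ * a ^ 2)
    (h₃ : z₁ * a' * (1 + a) = z₃ * b' ^ 2) (h₄ : z₃ * b' * (1 - b) = z₁ * a' ^ 2) :
    z₁ * a * (z₁ * a' ^ 2 + z₃ * b' ^ 2) = z₃ * b * (z₃ * b' ^ 2 - z₁ * a' ^ 2) ∧
    (z₁ * a' ^ 2 + z₃ * b' ^ 2) ^ 2 * (z₃ * b' ^ 2 - z₁ * a' ^ 2)
      = 4 * (z₁ * a' ^ 2) * (z₃ * (b * b')) * (z₃ * b') := by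
  -- The ratio m = z₁ / z₃ is the multiplier; dividing by z₃ leaves relations of weight zero.
  obtain ⟨m, rfl⟩ : ∃ m, z₁ = z₃ * m := ⟨z₁ / z₃, by field_simp⟩
  have m₁ : m * a * (1 + a') = b ^ 2 := mul_left_cancel₀ hz₃ (by linear_combination h₁)
  have m₂ : b * (1 - b') = m * a ^ 2 := mul_left_cancel₀ hz₃ (by linear_combination h₂)
  have m₃ : m * a' * (1 + a) = b' ^ 2 := mul_left_cancel₀ hz₃ (by linear_combination h₃)
  have m₄ : b' * (1 - b) = m * a' ^ 2 := mul_left_cancel₀ hz₃ (by linear_combination h₄)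
  -- With k = m a a', both m a and m a' are affine in k, and k² is the product of the second and
  -- fourth relations. Evaluating k (m a) = (m a²)(m a'), and its mirror image, gives two equations
  -- linear in k.
  obtain ⟨k, hk⟩ : ∃ k, k = m * a * a' := ⟨_, rfl⟩
  have n₁ : m * a = b ^ 2 - k := by linear_combination m₁ + hk
  have n₃ : m * a' = b' ^ 2 - k := by linear_combination m₃ + hk
  have k₂ : k ^ 2 = b * b' * (1 - b) * (1 - b') := by
    rw [hk]; linear_combination (-m * a ^ 2) * m₄ - b' * (1 - b) * m₂
  have c₁ : k * (1 + b - b') = b' * (1 - b') * (1 - b + b') := by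
    refine mul_left_cancel₀ hb ?_
    have : k * (b ^ 2 - k) = b * (1 - b') * (b' ^ 2 - k) := by
      rw [← n₁, ← n₃, m₂, hk]; ring
    linear_combination this + k₂
  have c₂ : k * (1 + b' - b) = b * (1 - b) * (1 - b' + b) := by
    refine mul_left_cancel₀ hb' ?_
    have : k * (b' ^ 2 - k) = b' * (1 - b) * (b ^ 2 - k) := by
      rw [← n₁, ← n₃, m₄, hk]; ring
    linear_combination this + k₂
  -- Eliminating k from `c₁` and `c₂` produces this relation times b - b', hence the hypothesis b ≠
  -- b'.
  have g : (1 + b' - b) ^ 2 * (b + b' - 1) = 4 * b * (1 - b) := by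
    refine mul_left_cancel₀ (sub_ne_zero.2 hbb) ?_
    linear_combination (1 + b - b') * c₂ - (1 + b' - b) * c₁
  have r : m * a * (1 + b' - b) = b * (b + b' - 1) := by
    rw [n₁]; linear_combination -c₂
  have hA : z₃ * m * a' ^ 2 = z₃ * b' * (1 - b) := by linear_combination -h₄
  rw [hA]
  constructor
  · linear_combination (z₃ ^ 2 * b') * r
  · linear_combination (z₃ ^ 3 * b' ^ 3) * g

end RamanujanLambert

/-! ### The modular relations for theta functions -/

namespace RamanujanLambert

open Filter Topology

variable {q : ℂ}

theorem differentiableOn_E : DifferentiableOn ℂ E (Metric.ball 0 1) := by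
  refine ModularForm.differentiableOn_tprod_one_sub_pow.congr fun q _ => ?_
  rw [E, qPochhammerInf]
  exact tprod_congr fun n => by rw [pow_succ']

theorem differentiableOn_E_pow {k : ℕ} (hk : k ≠ 0) :
    DifferentiableOn ℂ (fun q => E (q ^ k)) (Metric.ball 0 1) := by
  refine differentiableOn_E.comp (by fun_prop) fun q hq => ?_
  rw [mem_ball_zero_iff] at hq ⊢
  exact norm_pow_lt_one hq hk

/-- `φ(-q) φ(-q ^ 15)` as an eta-quotient. -/
noncomputable def etaA (q : ℂ) : ℂ := E q ^ 2 * E (q ^ 15) ^ 2 / (E (q ^ 2) * E (q ^ 30))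

/-- `φ(-q ^ 3) φ(-q ^ 5)` as an eta-quotient. -/
noncomputable def etaB (q : ℂ) : ℂ := E (q ^ 3) ^ 2 * E (q ^ 5) ^ 2 / (E (q ^ 6) * E (q ^ 10))

theorem phi_neg_pow_eq (hq : ‖q‖ < 1) {k : ℕ} (hk : k ≠ 0) :
    phi (-q ^ k) = E (q ^ k) ^ 2 / E (q ^ (2 * k)) := by
  rw [phi_neg_eq (norm_pow_lt_one hq hk), ← pow_mul, mul_comm 2 k]

theorem etaA_eq (hq : ‖q‖ < 1) : phi (-q) * phi (-q ^ 15) = etaA q := by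
  rw [phi_neg_eq hq, phi_neg_pow_eq hq (by norm_num), etaA, div_mul_div_comm]

theorem etaB_eq (hq : ‖q‖ < 1) : phi (-q ^ 3) * phi (-q ^ 5) = etaB q := by
  rw [phi_neg_pow_eq hq (by norm_num), phi_neg_pow_eq hq (by norm_num), etaB, div_mul_div_comm]

theorem E_pow_ne_zero (hq : ‖q‖ < 1) {k : ℕ} (hk : k ≠ 0) : E (q ^ k) ≠ 0 :=
  E_ne_zero _ (norm_pow_lt_one hq hk)

theorem theta_duplication_pow (hq0 : q ≠ 0) (hq : ‖q‖ < 1) {k : ℕ} (hk : k ≠ 0) :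
    Psi (q ^ k) ^ 2 = 2 * phi (q ^ k) * Psi (q ^ (2 * k)) ∧
      phi (-q ^ (2 * k)) ^ 2 = phi (q ^ k) * phi (-q ^ k) ∧
      Psi (-q ^ k) * phi (q ^ k) = Psi (q ^ k) * phi (-q ^ (2 * k)) := by
  have h := theta_duplication (pow_ne_zero k hq0) (norm_pow_lt_one hq hk)
  rwa [← pow_mul, mul_comm k 2] at h

/-- Normalising by z₁ = φ(q)φ(q^15) and z₃ = φ(q³)φ(q⁵) gives the quantities of `modular_relations`:
a and b come from ψ-products, a' and b' from φ-products. Classically they are eighth roots of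
products of moduli of degrees 1, 15 and 3, 5. The hypothesis `hne` is b ≠ b'. -/
theorem eta_relations (hq0 : q ≠ 0) (hq : ‖q‖ < 1)
    (hne : q / 2 * (Psi (q ^ 3) * Psi (q ^ 5)) ≠ phi (-q ^ 6) * phi (-q ^ 10)) :
    q ^ 2 / 2 * (Psi q * Psi (q ^ 15)) * (etaA q + etaB q)
      = q / 2 * (Psi (q ^ 3) * Psi (q ^ 5)) * (etaB q - etaA q) ∧
    (etaA q + etaB q) ^ 2 * (etaB q - etaA q)
      = 4 * etaA q * (q / 2 * (Psi (-q ^ 3) * Psi (-q ^ 5))) * (phi (-q ^ 6) * phi (-q ^ 10)) := by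
  obtain ⟨u1, u2, u3⟩ := theta_duplication hq0 hq
  obtain ⟨v1, v2, v3⟩ := theta_duplication_pow hq0 hq (k := 15) (by norm_num)
  obtain ⟨s1, s2, s3⟩ := theta_duplication_pow hq0 hq (k := 3) (by norm_num)
  obtain ⟨t1, t2, t3⟩ := theta_duplication_pow hq0 hq (k := 5) (by norm_num)
  have l1 := Psi_add_Psi_neg hq0 hq
  have l2 := Psi_sub_Psi_neg hq0 hq
  have l3 := phi_neg_three_five hq0 hq
  have l4 := phi_neg_one_fifteen hq0 hq
  rw [etaA_eq hq] at l4
  rw [etaB_eq hq] at l3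
  have hA := etaA_eq hq
  have hB := etaB_eq hq
  norm_num at v1 v2 v3 s1 s2 s3 t1 t2 t3
  have p1 := phi_ne_zero hq
  have p15 := phi_ne_zero (norm_pow_lt_one hq (k := 15) (by norm_num))
  have p3 := phi_ne_zero (norm_pow_lt_one hq (k := 3) (by norm_num))
  have p5 := phi_ne_zero (norm_pow_lt_one hq (k := 5) (by norm_num))
  have hPsi : ∀ {k : ℕ}, k ≠ 0 → Psi (q ^ k) ≠ 0 := by
    intro k hk
    rw [Psi_eq (pow_ne_zero k hq0) (norm_pow_lt_one hq hk), ← pow_mul]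
    exact div_ne_zero (mul_ne_zero two_ne_zero (pow_ne_zero 2 (E_pow_ne_zero hq (by omega))))
      (E_pow_ne_zero hq hk)
  have hphi : ∀ {k : ℕ}, k ≠ 0 → phi (-q ^ k) ≠ 0 := fun hk =>
    phi_ne_zero (by rw [norm_neg]; exact norm_pow_lt_one hq hk)
  obtain ⟨z₁, hz₁⟩ : ∃ z, z = phi q * phi (q ^ 15) := ⟨_, rfl⟩
  obtain ⟨z₃, hz₃⟩ : ∃ z, z = phi (q ^ 3) * phi (q ^ 5) := ⟨_, rfl⟩
  have n₁ : z₁ ≠ 0 := by rw [hz₁]; exact mul_ne_zero p1 p15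
  have n₃ : z₃ ≠ 0 := by rw [hz₃]; exact mul_ne_zero p3 p5
  obtain ⟨X₁, hX₁⟩ : ∃ x, x = q ^ 2 / 2 * (Psi q * Psi (q ^ 15)) := ⟨_, rfl⟩
  obtain ⟨X₃, hX₃⟩ : ∃ x, x = q / 2 * (Psi (q ^ 3) * Psi (q ^ 5)) := ⟨_, rfl⟩
  obtain ⟨K₁, hK₁⟩ : ∃ x, x = q ^ 2 / 2 * (Psi (-q) * Psi (-q ^ 15)) := ⟨_, rfl⟩
  obtain ⟨K₃, hK₃⟩ : ∃ x, x = q / 2 * (Psi (-q ^ 3) * Psi (-q ^ 5)) := ⟨_, rfl⟩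
  obtain ⟨W₁, hW₁⟩ : ∃ x, x = q ^ 4 * (Psi (q ^ 2) * Psi (q ^ 30)) := ⟨_, rfl⟩
  obtain ⟨W₃, hW₃⟩ : ∃ x, x = q ^ 2 * (Psi (q ^ 6) * Psi (q ^ 10)) := ⟨_, rfl⟩
  obtain ⟨Y₁, hY₁⟩ : ∃ x, x = phi (-q ^ 2) * phi (-q ^ 30) := ⟨_, rfl⟩
  obtain ⟨Y₃, hY₃⟩ : ∃ x, x = phi (-q ^ 6) * phi (-q ^ 10) := ⟨_, rfl⟩
  -- The duplication formulas make every other quantity a monomial: W₁ = z₁ a², A = z₁ a'², K₁ = z₁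
  -- a a', and likewise for index 3. The linear identities `r1` to `r4` then become the four
  -- hypotheses.
  have a1 : X₁ ^ 2 = z₁ * W₁ := by
    rw [hX₁, hz₁, hW₁]
    linear_combination (q ^ 4 / 4) * (Psi (q ^ 15) ^ 2 * u1 + 2 * phi q * Psi (q ^ 2) * v1)
  have a2 : Y₁ ^ 2 = z₁ * etaA q := by
    rw [hY₁, hz₁, ← hA]
    linear_combination phi (-q ^ 30) ^ 2 * u2 + phi q * phi (-q) * v2
  have a3 : K₁ * z₁ = X₁ * Y₁ := by
    rw [hX₁, hz₁, hY₁, hK₁]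
    linear_combination (q ^ 2 / 2) * (Psi (-q ^ 15) * phi (q ^ 15) * u3
      + Psi q * phi (-q ^ 2) * v3)
  have b1 : X₃ ^ 2 = z₃ * W₃ := by
    rw [hX₃, hz₃, hW₃]
    linear_combination (q ^ 2 / 4) * (Psi (q ^ 5) ^ 2 * s1 + 2 * phi (q ^ 3) * Psi (q ^ 6) * t1)
  have b2 : Y₃ ^ 2 = z₃ * etaB q := by
    rw [hY₃, hz₃, ← hB]
    linear_combination phi (-q ^ 10) ^ 2 * s2 + phi (q ^ 3) * phi (-q ^ 3) * t2
  have b3 : K₃ * z₃ = X₃ * Y₃ := by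
    rw [hX₃, hz₃, hY₃, hK₃]
    linear_combination (q / 2) * (Psi (-q ^ 5) * phi (q ^ 5) * s3
      + Psi (q ^ 3) * phi (-q ^ 6) * t3)
  have r1 : X₁ + K₁ = W₃ := by rw [hX₁, hK₁, hW₃]; linear_combination (q ^ 2 / 2) * l1
  have r2 : X₃ - K₃ = W₁ := by rw [hX₃, hK₃, hW₁]; linear_combination (q / 2) * l2
  have r3 : Y₁ + K₁ = etaB q := by rw [hY₁, hK₁]; exact l3
  have r4 : Y₃ - K₃ = etaA q := by rw [hY₃, hK₃]; exact l4
  have x3 : X₃ ≠ 0 := by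
    rw [hX₃]
    exact mul_ne_zero (div_ne_zero hq0 two_ne_zero)
      (mul_ne_zero (hPsi three_ne_zero) (hPsi (by norm_num)))
  have y3 : Y₃ ≠ 0 := by
    rw [hY₃]; exact mul_ne_zero (hphi (by norm_num)) (hphi (by norm_num))
  rw [← hX₃, ← hY₃] at hne
  rw [← hX₁, ← hX₃, ← hK₃, ← hY₃]
  have eA : z₁ * (Y₁ / z₁) ^ 2 = etaA q := by field_simp; linear_combination a2
  have eB : z₃ * (Y₃ / z₃) ^ 2 = etaB q := by field_simp; linear_combination b2
  have eW₁ : z₁ * (X₁ / z₁) ^ 2 = W₁ := by field_simp; linear_combination a1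
  have eW₃ : z₃ * (X₃ / z₃) ^ 2 = W₃ := by field_simp; linear_combination b1
  have eK₁ : z₁ * (X₁ / z₁ * (Y₁ / z₁)) = K₁ := by field_simp; linear_combination -a3
  have eK₃ : z₃ * (X₃ / z₃ * (Y₃ / z₃)) = K₃ := by field_simp; linear_combination -b3
  have eX₁ : z₁ * (X₁ / z₁) = X₁ := by field_simp
  have eX₃ : z₃ * (X₃ / z₃) = X₃ := by field_simp
  have eY₁ : z₁ * (Y₁ / z₁) = Y₁ := by field_simp
  have eY₃ : z₃ * (Y₃ / z₃) = Y₃ := by field_simp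
  have main := modular_relations (z₁ := z₁) (z₃ := z₃) (a := X₁ / z₁) (a' := Y₁ / z₁)
    (b := X₃ / z₃) (b' := Y₃ / z₃) n₃ (div_ne_zero x3 n₃) (div_ne_zero y3 n₃)
    (fun h => hne (by rw [← eX₃, h, eY₃]))
    (by rw [eW₃]; linear_combination eX₁ + eK₁ + r1)
    (by rw [eW₁]; linear_combination eX₃ - eK₃ + r2)
    (by rw [eB]; linear_combination eY₁ + eK₁ + r3)
    (by rw [eA]; linear_combination eY₃ - eK₃ + r4)
  rwa [eA, eB, eX₁, eX₃, eK₃, eY₃] at main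

end RamanujanLambert

/-! ### Cube roots, the identity theorem and the conclusion -/

namespace RamanujanLambert

open Filter Topology

variable {q : ℂ}

/-- As eta-quotients, the ratio of the two ψ-products in the first relation is Q / P, and the right
side of the second is 8 P² Q. Multiplying the second by P and using the first leaves a common factor
Q, nonzero for q ≠ 0. -/
theorem eta_cube (hq0 : q ≠ 0) (hq : ‖q‖ < 1)
    (hne : q / 2 * (Psi (q ^ 3) * Psi (q ^ 5)) ≠ phi (-q ^ 6) * phi (-q ^ 10)) :
    (etaA q + etaB q) ^ 3 = (2 * P q) ^ 3 ∧ P q * (etaB q - etaA q) = Q q * (etaA q + etaB q) := by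
  obtain ⟨h1, h2⟩ := eta_relations hq0 hq hne
  have hPsi : ∀ {k : ℕ}, k ≠ 0 → Psi (q ^ k) = 2 * E (q ^ (2 * k)) ^ 2 / E (q ^ k) := by
    intro k hk
    rw [Psi_eq (pow_ne_zero k hq0) (norm_pow_lt_one hq hk), ← pow_mul, mul_comm 2 k]
  have hPsi' : ∀ {k : ℕ}, k ≠ 0 →
      Psi (-q ^ k) = 2 * E (q ^ k) * E (q ^ (4 * k)) / E (q ^ (2 * k)) := by
    intro k hk
    rw [Psi_neg_eq (pow_ne_zero k hq0) (norm_pow_lt_one hq hk), ← pow_mul, ← pow_mul,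
      mul_comm 2 k, mul_comm 4 k]
  have g : ∀ {k : ℕ}, k ≠ 0 → E (q ^ k) ≠ 0 := fun hk => E_pow_ne_zero hq hk
  have g1 := E_ne_zero q hq
  have g2 := g (k := 2) (by norm_num)
  have g3 := g (k := 3) (by norm_num)
  have g5 := g (k := 5) (by norm_num)
  have g6 := g (k := 6) (by norm_num)
  have g10 := g (k := 10) (by norm_num)
  have g12 := g (k := 12) (by norm_num)
  have g15 := g (k := 15) (by norm_num)
  have g20 := g (k := 20) (by norm_num)
  have g30 := g (k := 30) (by norm_num)
  have e1 := Psi_eq hq0 hq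
  have e15 := hPsi (k := 15) (by norm_num)
  have e3 := hPsi (k := 3) (by norm_num)
  have e5 := hPsi (k := 5) (by norm_num)
  have n3 := hPsi' (k := 3) (by norm_num)
  have n5 := hPsi' (k := 5) (by norm_num)
  have f6 := phi_neg_pow_eq hq (k := 6) (by norm_num)
  have f10 := phi_neg_pow_eq hq (k := 10) (by norm_num)
  norm_num at e15 e3 e5 n3 n5 f6 f10
  rw [e1, e15, e3, e5] at h1
  rw [n3, n5, f6, f10] at h2
  have h1' : P q * (etaB q - etaA q) = Q q * (etaA q + etaB q) := by
    rw [P, Q]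
    generalize etaA q = A at *
    generalize etaB q = B at *
    field_simp at h1 ⊢
    linear_combination -h1
  refine ⟨?_, h1'⟩
  have hP : P q ≠ 0 :=
    div_ne_zero (mul_ne_zero (mul_ne_zero (mul_ne_zero g1 g6) g10) g15) (mul_ne_zero g2 g30)
  have h3 : 4 * etaA q * (q / 2 * (2 * E (q ^ 3) * E (q ^ 12) / E (q ^ 6) *
      (2 * E (q ^ 5) * E (q ^ 20) / E (q ^ 10)))) *
      (E (q ^ 6) ^ 2 / E (q ^ 12) * (E (q ^ 10) ^ 2 / E (q ^ 20))) = 8 * P q ^ 2 * Q q := by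
    rw [etaA, P, Q]
    field_simp
    ring
  rw [h3] at h2
  have hQ : Q q ≠ 0 :=
    mul_ne_zero hq0 (div_ne_zero (mul_ne_zero (mul_ne_zero (mul_ne_zero g2 g3) g5) g30)
      (mul_ne_zero g6 g10))
  refine mul_left_cancel₀ hQ ?_
  linear_combination P q * h2 - (etaA q + etaB q) ^ 2 * h1'

theorem differentiableOn_P : DifferentiableOn ℂ P (Metric.ball 0 1) := by
  have g := @differentiableOn_E_pow
  refine (((differentiableOn_E.mul (g (k := 6) (by norm_num))).mul (g (k := 10) (by norm_num))).mul
    (g (k := 15) (by norm_num))).div ((g (k := 2) (by norm_num)).mul (g (k := 30) (by norm_num)))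
    fun q hq => ?_
  rw [mem_ball_zero_iff] at hq
  exact mul_ne_zero (E_pow_ne_zero hq (by norm_num)) (E_pow_ne_zero hq (by norm_num))

theorem differentiableOn_Q : DifferentiableOn ℂ Q (Metric.ball 0 1) := by
  have g := @differentiableOn_E_pow
  refine differentiableOn_id.mul (((((g (k := 2) (by norm_num)).mul (g (k := 3) (by norm_num))).mul
    (g (k := 5) (by norm_num))).mul (g (k := 30) (by norm_num))).div
    ((g (k := 6) (by norm_num)).mul (g (k := 10) (by norm_num))) fun q hq => ?_)
  rw [mem_ball_zero_iff] at hq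
  exact mul_ne_zero (E_pow_ne_zero hq (by norm_num)) (E_pow_ne_zero hq (by norm_num))

theorem differentiableOn_etaA : DifferentiableOn ℂ etaA (Metric.ball 0 1) := by
  have g := @differentiableOn_E_pow
  refine ((differentiableOn_E.pow 2).mul ((g (k := 15) (by norm_num)).pow 2)).div
    ((g (k := 2) (by norm_num)).mul (g (k := 30) (by norm_num))) fun q hq => ?_
  rw [mem_ball_zero_iff] at hq
  exact mul_ne_zero (E_pow_ne_zero hq (by norm_num)) (E_pow_ne_zero hq (by norm_num))

theorem differentiableOn_etaB : DifferentiableOn ℂ etaB (Metric.ball 0 1) := by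
  have g := @differentiableOn_E_pow
  refine (((g (k := 3) (by norm_num)).pow 2).mul ((g (k := 5) (by norm_num)).pow 2)).div
    ((g (k := 6) (by norm_num)).mul (g (k := 10) (by norm_num))) fun q hq => ?_
  rw [mem_ball_zero_iff] at hq
  exact mul_ne_zero (E_pow_ne_zero hq (by norm_num)) (E_pow_ne_zero hq (by norm_num))

theorem ball_mem_nhds_zero : Metric.ball (0 : ℂ) 1 ∈ 𝓝 0 :=
  Metric.isOpen_ball.mem_nhds (Metric.mem_ball_self one_pos)

theorem P_zero : P 0 = 1 := by simp [P, E_zero]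

theorem etaA_zero : etaA 0 = 1 := by simp [etaA, E_zero]

theorem etaB_zero : etaB 0 = 1 := by simp [etaB, E_zero]

/-- As q → 0 the left side tends to 0 and the right side to 1; the eta-quotient forms supply the
continuity at 0. -/
theorem eventually_ne_Psi : ∀ᶠ q : ℂ in 𝓝[≠] 0,
    q / 2 * (Psi (q ^ 3) * Psi (q ^ 5)) ≠ phi (-q ^ 6) * phi (-q ^ 10) := by
  have g := @differentiableOn_E_pow
  have hd : DifferentiableOn ℂ (fun q => 2 * q * (E (q ^ 6) ^ 2 / E (q ^ 3)) *
      (E (q ^ 10) ^ 2 / E (q ^ 5)) - E (q ^ 6) ^ 2 / E (q ^ 12) * (E (q ^ 10) ^ 2 / E (q ^ 20)))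
      (Metric.ball 0 1) := by
    have d : ∀ {j k : ℕ}, j ≠ 0 → k ≠ 0 →
        DifferentiableOn ℂ (fun q => E (q ^ j) ^ 2 / E (q ^ k)) (Metric.ball 0 1) := by
      intro j k hj hk
      refine ((g hj).pow 2).div (g hk) fun q hq => E_pow_ne_zero (by simpa using hq) hk
    exact (((differentiableOn_id.const_mul 2).mul (d (by norm_num) (by norm_num))).mul
      (d (by norm_num) (by norm_num))).sub
      ((d (by norm_num) (by norm_num)).mul (d (by norm_num) (by norm_num)))
  have hc := hd.continuousOn.continuousAt ball_mem_nhds_zero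
  have h0 := hc.eventually_ne (y := 0) (by simp [E_zero])
  filter_upwards [h0.filter_mono nhdsWithin_le_nhds, self_mem_nhdsWithin,
    mem_nhdsWithin_of_mem_nhds ball_mem_nhds_zero] with q h1 hq0 hq h2
  rw [mem_ball_zero_iff] at hq
  refine h1 ?_
  rw [Psi_eq (pow_ne_zero 3 hq0) (norm_pow_lt_one hq (by norm_num)),
    Psi_eq (pow_ne_zero 5 hq0) (norm_pow_lt_one hq (by norm_num)),
    phi_neg_pow_eq hq (by norm_num), phi_neg_pow_eq hq (by norm_num), ← pow_mul, ← pow_mul] at h2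
  norm_num at h2
  linear_combination h2

/-- The identity theorem on the unit disc. -/
theorem eq_zero_of_eventually_eq_zero {f : ℂ → ℂ} (hf : DifferentiableOn ℂ f (Metric.ball 0 1))
    (h : ∀ᶠ q in 𝓝[≠] 0, f q = 0) (hq : ‖q‖ < 1) : f q = 0 :=
  (hf.analyticOnNhd Metric.isOpen_ball).eqOn_zero_of_preconnected_of_frequently_eq_zero
    (convex_ball (0 : ℂ) 1).isPreconnected (Metric.mem_ball_self one_pos) h.frequently
    (mem_ball_zero_iff.2 hq)

theorem eventually_etaA_add_etaB : ∀ᶠ q : ℂ in 𝓝[≠] 0, etaA q + etaB q = 2 * P q := by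
  have cA := differentiableOn_etaA.continuousOn.continuousAt ball_mem_nhds_zero
  have cB := differentiableOn_etaB.continuousOn.continuousAt ball_mem_nhds_zero
  have cP := differentiableOn_P.continuousOn.continuousAt ball_mem_nhds_zero
  -- With S = A + B and T = 2P, S³ = T³ factors as (S - T)(S² + ST + T²) = 0, and the second factor
  -- equals 12 at q = 0.
  have c : ContinuousAt (fun q => (etaA q + etaB q) ^ 2 + (etaA q + etaB q) * (2 * P q)
      + (2 * P q) ^ 2) 0 := by fun_prop
  have h0 := c.eventually_ne (y := 0) (by norm_num [etaA_zero, etaB_zero, P_zero])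
  filter_upwards [h0.filter_mono nhdsWithin_le_nhds, self_mem_nhdsWithin,
    mem_nhdsWithin_of_mem_nhds ball_mem_nhds_zero, eventually_ne_Psi] with q h1 hq0 hq h2
  rw [mem_ball_zero_iff] at hq
  have h3 := (eta_cube hq0 hq h2).1
  refine sub_eq_zero.1 ((mul_eq_zero.1 ?_).resolve_right h1)
  linear_combination h3

theorem etaA_add_etaB (hq : ‖q‖ < 1) : etaA q + etaB q = 2 * P q := by
  refine sub_eq_zero.1 (eq_zero_of_eventually_eq_zero (f := fun q => etaA q + etaB q - 2 * P q)
    ((differentiableOn_etaA.add differentiableOn_etaB).sub (differentiableOn_P.const_mul 2)) ?_ hq)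
  filter_upwards [eventually_etaA_add_etaB] with q h
  rw [h, sub_self]

theorem etaB_sub_etaA (hq : ‖q‖ < 1) : etaB q - etaA q = 2 * Q q := by
  refine sub_eq_zero.1 (eq_zero_of_eventually_eq_zero (f := fun q => etaB q - etaA q - 2 * Q q)
    ((differentiableOn_etaB.sub differentiableOn_etaA).sub (differentiableOn_Q.const_mul 2)) ?_ hq)
  -- P(0) = 1, so P can be cancelled near 0 from P (B - A) = 2 P Q.
  have cP := (differentiableOn_P.continuousOn.continuousAt ball_mem_nhds_zero).eventually_ne
    (y := 0) (by simp [P_zero])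
  filter_upwards [cP.filter_mono nhdsWithin_le_nhds, self_mem_nhdsWithin,
    mem_nhdsWithin_of_mem_nhds ball_mem_nhds_zero, eventually_ne_Psi] with q h1 hq0 hq h2
  rw [mem_ball_zero_iff] at hq
  have h3 := (eta_cube hq0 hq h2).2
  rw [etaA_add_etaB hq] at h3
  refine mul_left_cancel₀ h1 ?_
  linear_combination h3

theorem P_eq (hq : ‖q‖ < 1) : P q = 1 - ∑' n : ℕ+, termP q n := by
  rcases eq_or_ne q 0 with rfl | hq0
  · have : ∀ n : ℕ+, termP 0 n = 0 := fun n => by simp [termP]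
    simp [P_zero, this]
  · exact P_eq_of_ne_zero hq0 hq

theorem Q_eq (hq : ‖q‖ < 1) : Q q = ∑' n : ℕ+, termQ q n := by
  rcases eq_or_ne q 0 with rfl | hq0
  · have : ∀ n : ℕ+, termQ 0 n = 0 := fun n => by simp [termQ]
    simp [Q, this]
  · exact Q_eq_of_ne_zero hq0 hq

theorem phi_neg_mul_phi_neg_fifteen (hq : ‖q‖ < 1) : phi (-q) * phi (-q ^ 15) = P q - Q q := by
  rw [etaA_eq hq]
  linear_combination (etaA_add_etaB hq - etaB_sub_etaA hq) / 2

theorem phi_neg_cube_mul_phi_neg_five (hq : ‖q‖ < 1) :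
    phi (-q ^ 3) * phi (-q ^ 5) = P q + Q q := by
  rw [etaB_eq hq]
  linear_combination (etaA_add_etaB hq + etaB_sub_etaA hq) / 2

end RamanujanLambert

theorem theorem5p1 (q : ℂ) (hq : ‖q‖ < 1) :
    (Summable (fun n : ℕ+ => termP q n) ∧ P q = 1 - (∑' n : ℕ+, termP q n)) ∧
    (Summable (fun n : ℕ+ => termQ q n) ∧ Q q = ∑' n : ℕ+, termQ q n) ∧
    (phi (-q) * phi (-(q ^ 15)) = P q - Q q ∧
      phi (-q) * phi (-(q ^ 15)) = 1 - (∑' n : ℕ+, termP q n) - (∑' n : ℕ+, termQ q n)) ∧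
    (phi (-(q ^ 3)) * phi (-(q ^ 5)) = P q + Q q ∧
      phi (-(q ^ 3)) * phi (-(q ^ 5)) =
        1 - (∑' n : ℕ+, termP q n) + (∑' n : ℕ+, termQ q n)) := by
  refine ⟨⟨summable_termP hq, P_eq hq⟩, ⟨summable_termQ hq, Q_eq hq⟩,
    ⟨phi_neg_mul_phi_neg_fifteen hq, ?_⟩, phi_neg_cube_mul_phi_neg_five hq, ?_⟩
  · rw [phi_neg_mul_phi_neg_fifteen hq, P_eq hq, Q_eq hq]
  · rw [phi_neg_cube_mul_phi_neg_five hq, P_eq hq, Q_eq hq]
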